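/- Let $\lambda,\sigma_2\ge 0$, let $\sigma_1,\kappa,\rho,\delta>0$, and put $\bar\sigma_1:=1/\sigma_1$. Let $c:[0,\infty)\to[0,\infty)$ be strictly increasing, strictly convex and twice continuously differentiable (one-sided at $0$). Put $$f(\gamma,h):=-(\bar\sigma_1^2+h)\gamma^2-2\lambda\gamma+\sigma_2^2,\qquad \gamma^0_\infty:=-\lambda\sigma_1^2+\sqrt{\lambda^2\sigma_1^4+\sigma_1^2\sigma_2^2},$$ $$a_1:=\frac{-\delta\rho+\sqrt{\delta^2\rho^2+4\kappa\rho}}{4},\quad a_3:=\frac{2a_1\rho}{\delta\rho+\lambda\rho+2a_1},\quad a_2:=\frac{a_3(2\rho-a_3)}{2\rho(2\lambda+\delta)},\quad \bar a:=a_3-a_2(2\lambda+\delta)=\frac{a_3^2}{2\rho}.$$ Fix $\gamma_{\max}>\gamma^0_\infty$, put $M_0:=\gamma_{\max}^2\,\bar a/\delta$, and assume that $M_0\le c'(h)$ for some $h\ge 0$. For $x\le M_0$ let $\hat h(x):=0$ if $x<c'(0)$ and $\hat h(x):=(c')^{-1}(x)$ if $x\ge c'(0)$, and let $h_{\max}:=\hat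 h(M_0)$. For $\gamma_0\in[0,\gamma_{\max}]$ let $$v(\gamma_0):=\inf_h\int_0^\infty e^{-\delta t}\bigl(\bar a\,\gamma_t+c(h_t)\bigr)\,dt,$$ where the infimum is over all Borel measurable $h:[0,\infty)\to[0,h_{\max}]$ and $\gamma$ is the absolutely continuous solution of $d\gamma_t=f(\gamma_t,h_t)\,dt$, $\gamma_{t=0}=\gamma_0$. Let $v'$ denote the derivative of $v$ (one-sided at $0$ and at $\gamma_{\max}$), and let $H^*(\gamma):=\hat h(\gamma^2v'(\gamma))$ for $\gamma\in[0,\gamma_{\max}]$. Let $\check v(p):=v(1/p)$ for $p\in[1/\gamma_{\max},\infty]$, with $1/\infty:=0$ and $\check v'(\infty):=0$, and let $\gamma_{\mathcal D}:=1/(\check v')^{-1}(-c'(0))$ if $-c'(0)$ is a value of $\check v'$, and $\gamma_{\mathcal D}:=\gamma_{\max}$ otherwise. Then there is exactly one $\gamma_{\mathrm{eq}}\in[0,\gamma^0_\infty]$ with $f(\gamma_{\mathrm{eq}},H^*(\gamma_{\mathrm{eq}}))=0$. With $h_{\mathrm{eq}}:=H^*(\gamma_{\mathrm{eq}})$ the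 following hold. 1. $v(\gamma_{\mathrm{eq}})=\frac1\delta\bigl(\bar a\,\gamma_{\mathrm{eq}}+c(h_{\mathrm{eq}})\bigr)$. 2. If $\gamma_{\mathrm{eq}}\in[0,\gamma_{\mathcal D}]$, then $h_{\mathrm{eq}}=0$. If $\gamma_{\mathrm{eq}}\in(0,\gamma_{\mathcal D})$, then $v$ is differentiable at $\gamma_{\mathrm{eq}}$ and $$v'(\gamma_{\mathrm{eq}})=\frac{\bar a}{2\bar\sigma_1^2\gamma_{\mathrm{eq}}+2\lambda+\delta}.$$ 3. If $\gamma_{\mathrm{eq}}\in(\gamma_{\mathcal D},\gamma_{\max}]$, then $v$ is differentiable at $\gamma_{\mathrm{eq}}$ and $$h_{\mathrm{eq}}=-\frac{1}{\gamma_{\mathrm{eq}}^2}\bigl(2\lambda\gamma_{\mathrm{eq}}-\sigma_2^2\bigr)-\bar\sigma_1^2,\qquad v'(\gamma_{\mathrm{eq}})=\frac{1}{\gamma_{\mathrm{eq}}^2}\,c'\Bigl(-\frac{1}{\gamma_{\mathrm{eq}}^2}\bigl(2\lambda\gamma_{\mathrm{eq}}-\sigma_2^2\bigr)-\bar\sigma_1^2\Bigr).$$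 -/

import Mathlib

open Set MeasureTheory

noncomputable section

namespace InfoAcq

/-- Data of the model: mean-reversion speed `lam`, volatilities `σ₁`, `σ₂`, cost coefficients
`κ`, `ρ`, discount rate `δ`, upper bound `γmax` of the conditional variance, and information
cost `c` (only its values on `[0,∞)` matter). -/
structure Model where
  lam : ℝ
  σ₁ : ℝ
  σ₂ : ℝ
  κ : ℝ
  ρ : ℝ
  δ : ℝ
  γmax : ℝ
  c : ℝ → ℝ

namespace Model

variable (P : Model)

/-- `σ̄₁ = 1 / σ₁`. -/
def sbar : ℝ := 1 / P.σ₁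

/-- Controlled drift `f(γ,h)` of the conditional variance. -/
def f (γ h : ℝ) : ℝ := -(P.sbar ^ 2 + h) * γ ^ 2 - 2 * P.lam * γ + P.σ₂ ^ 2

/-- Equilibrium `γ⁰_∞` of the uncontrolled conditional variance. -/
def γinf : ℝ := -P.lam * P.σ₁ ^ 2 + √(P.lam ^ 2 * P.σ₁ ^ 4 + P.σ₁ ^ 2 * P.σ₂ ^ 2)

def a₁ : ℝ := -(P.δ * P.ρ) / 4 + √(P.δ ^ 2 * P.ρ ^ 2 + 4 * P.κ * P.ρ) / 4

def a₃ : ℝ := 2 * P.a₁ * P.ρ / (P.δ * P.ρ + P.lam * P.ρ + 2 * P.a₁)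

def a₂ : ℝ := P.a₃ * (2 * P.ρ - P.a₃) / (2 * P.ρ * (2 * P.lam + P.δ))

/-- The coefficient `ā` of the conditional variance in the running cost. -/
def abar : ℝ := P.a₃ - P.a₂ * (2 * P.lam + P.δ)

/-- `c'` on `[0,∞)`, one-sided at `0`. -/
def dc (h : ℝ) : ℝ := derivWithin P.c (Ici 0) h

/-- `M₀ = γmax² ā / δ`. -/
def M₀ : ℝ := P.γmax ^ 2 * (P.abar / P.δ)

open Classical in
/-- `ĥ(x)`: zero for `x < c'(0)` and `(c')⁻¹(x)` for `x ≥ c'(0)`. -/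
def hhat (x : ℝ) : ℝ := if x < P.dc 0 then 0 else Function.invFunOn P.dc (Ici 0) x

/-- `h_max = (c')⁻¹(M₀)`, read as `0` in case `M₀ < c'(0)`. -/
def hmax : ℝ := P.hhat P.M₀

/-- Admissible rates: Borel functions `h : [0,∞) → [0,h_max]` (extended to `ℝ` in any Borel way). -/
def Admissible (h : ℝ → ℝ) : Prop :=
  Measurable h ∧ ∀ t, 0 ≤ t → h t ∈ Icc 0 P.hmax

/-- `γ` is the absolutely continuous solution on `[0,∞)` of `dγ = f(γ,h) dt`, `γ(0) = γ₀`. Since `h`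
is bounded and Borel and `γ` continuous, the integrand is locally integrable, so the integral
equation is the same as absolute continuity together with the equation almost everywhere. -/
def IsState (h : ℝ → ℝ) (γ₀ : ℝ) (γ : ℝ → ℝ) : Prop :=
  ContinuousOn γ (Ici 0) ∧ ∀ t, 0 ≤ t → γ t = γ₀ + ∫ s in (0 : ℝ)..t, P.f (γ s) (h s)

/-- Discounted cost `∫₀^∞ e^{-δt} (ā γ_t + c(h_t)) dt` of a control and its state. -/
def cost (h γ : ℝ → ℝ) : ℝ :=
  ∫ t in Ioi (0 : ℝ), Real.exp (-P.δ * t) * (P.abar * γ t + P.c (h t))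

/-- Value function: infimum of the cost over all admissible rates and their states. -/
def v (γ₀ : ℝ) : ℝ :=
  sInf {J | ∃ h γ : ℝ → ℝ, P.Admissible h ∧ P.IsState h γ₀ γ ∧ J = P.cost h γ}

/-- `v'` on `[0,γmax]`, one-sided at the end points. -/
def dv (γ : ℝ) : ℝ := derivWithin P.v (Icc 0 P.γmax) γ

/-- Feedback map `H*(γ) = ĥ(γ² v'(γ))`. -/
def H (γ : ℝ) : ℝ := P.hhat (γ ^ 2 * P.dv γ)

/-- Value function in terms of the conditional precision `p = 1/γ`. -/
def vcheck (p : ℝ) : ℝ := P.v (1 / p)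

/-- Its derivative on `[1/γmax,∞)`, one-sided at the left end point. -/
def dvcheck (p : ℝ) : ℝ := derivWithin P.vcheck (Ici (1 / P.γmax)) p

open Classical in
/-- Threshold `γ_D = 1/(v̌')⁻¹(-c'(0))` if `-c'(0)` is a value of `v̌'` on `[1/γmax,∞]`, and `γmax`
otherwise. Here `v̌'(∞) = 0` and `1/∞ = 0`; this value belongs to the first case. -/
def γD : ℝ :=
  if P.dc 0 = 0 then 0
  else if -P.dc 0 ∈ P.dvcheck '' Ici (1 / P.γmax) then
    1 / Function.invFunOn P.dvcheck (Ici (1 / P.γmax)) (-P.dc 0)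
  else P.γmax

/-- `γ` is an equilibrium of the optimally controlled conditional variance. -/
def IsEquilibrium (γ : ℝ) : Prop := γ ∈ Icc 0 P.γinf ∧ P.f γ (P.H γ) = 0

end Model

end InfoAcq

end

/-! For a fixed control the state depends monotonically and concavely on its initial value, because
`f` is decreasing and concave in `γ ≥ 0`. Hence `v` is concave. In the precision `p = 1/γ` the
dynamics read `p' = σ̄₁² + h + 2λp - σ₂²p²`, which is jointly concave in `(p, h)`, while the running
cost `ā/p + c(h)` is convex and decreasing in `p`. Mixing controls together with initial precisions
therefore shows that `v̌` is convex. At each `γ > 0` the graph of `v` lies between a line above and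
a curve affine in `1/γ` below, both touching it, so `v` is differentiable there
(`differentiableAt_v`), and `γ²v'(γ) = -v̌'(1/γ)` is nondecreasing.

Uniqueness, for `σ₂ > 0`: `H*` is nondecreasing, whereas the rate for which `γ` is a rest point,
`σ₂²/γ² - 2λ/γ - σ̄₁²`, is strictly decreasing on `(0, γ⁰_∞]`.

Existence and the formulas need neither a Hamilton–Jacobi equation nor an optimal control. A rest
point of the Pontryagin system is a pair `(γ, m)` with `f(γ, h) = 0`, `h = ĥ(γ²m)` and `m(δ - ∂f/∂γ)
= ā`; `exists_stationary` finds one by the intermediate value theorem. The function of `p` that is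
affine with value `(āγ + c(h))/δ` and slope `-γ²m` at `1/γ` is a subsolution along every control,
hence bounds every cost from below (`le_cost_of_stationary`). The constant control attains the bound
at `γ`, which gives `v(γ)`. Since `v` is differentiable and touches this minorant, `v'(γ) = m`; thus
`H*(γ) = h` and `γ` is the equilibrium. The two cases for `h_eq` come from comparing `γ²v'(γ)` with
`c'(0)`, using its monotonicity.

If `σ₂ = 0`, then `γ⁰_∞ = 0` and the only candidate is `0`. -/

namespace InfoAcq

/-! ### Calculus and comparison for absolutely continuous functions. -/

/-- `u` is locally absolutely continuous on `[0,∞)` with almost everywhere derivative `g`. -/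
structure IsPrimitive (u g : ℝ → ℝ) : Prop where
  ac : ∀ T, 0 ≤ T → AbsolutelyContinuousOnInterval u 0 T
  ae_deriv : ∀ᵐ t ∂volume.restrict (Ioi (0 : ℝ)), HasDerivAt u (g t) t

theorem _root_.AbsolutelyContinuousOnInterval.of_dist_le {u w : ℝ → ℝ} {a b K : ℝ}
    (hu : AbsolutelyContinuousOnInterval u a b) (hK : 0 ≤ K)
    (h : ∀ x ∈ uIcc a b, ∀ y ∈ uIcc a b, dist (w x) (w y) ≤ K * dist (u x) (u y)) :
    AbsolutelyContinuousOnInterval w a b := by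
  rw [absolutelyContinuousOnInterval_iff] at hu ⊢
  intro ε hε
  obtain ⟨η, hη, H⟩ := hu (ε / (K + 1)) (by positivity)
  refine ⟨η, hη, fun E hE hE' => ?_⟩
  have h1 := H E hE hE'
  calc ∑ i ∈ Finset.range E.1, dist (w (E.2 i).1) (w (E.2 i).2)
      ≤ ∑ i ∈ Finset.range E.1, K * dist (u (E.2 i).1) (u (E.2 i).2) :=
        Finset.sum_le_sum fun i hi => h _ (hE.1 i hi).1 _ (hE.1 i hi).2
    _ = K * ∑ i ∈ Finset.range E.1, dist (u (E.2 i).1) (u (E.2 i).2) := by rw [Finset.mul_sum]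
    _ ≤ K * (ε / (K + 1)) := by gcongr
    _ < (K + 1) * (ε / (K + 1)) := by gcongr; linarith
    _ = ε := by field

namespace IsPrimitive

variable {u w g k : ℝ → ℝ}

theorem continuousOn (hu : IsPrimitive u g) : ContinuousOn u (Ici 0) := by
  intro t ht
  have ht' : (0 : ℝ) ≤ t := ht
  have h := (hu.ac (t + 1) (by linarith)).continuousOn
  rw [uIcc_of_le (by linarith)] at h
  refine (h t ⟨ht, by linarith⟩).mono_of_mem_nhdsWithin ?_
  rw [← Ici_inter_Iic]
  exact inter_mem_nhdsWithin _ (Iic_mem_nhds (by linarith))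

theorem congr_deriv (hu : IsPrimitive u g) (h : ∀ t, 0 < t → g t = k t) : IsPrimitive u k := by
  refine ⟨hu.ac, ?_⟩
  filter_upwards [hu.ae_deriv, ae_restrict_mem measurableSet_Ioi] with t ht h0
  rw [← h t h0]; exact ht

theorem add (hu : IsPrimitive u g) (hw : IsPrimitive w k) :
    IsPrimitive (fun t => u t + w t) (fun t => g t + k t) := by
  refine ⟨fun T hT => (hu.ac T hT).fun_add (hw.ac T hT), ?_⟩
  filter_upwards [hu.ae_deriv, hw.ae_deriv] with t h1 h2 using h1.add h2

theorem sub (hu : IsPrimitive u g) (hw : IsPrimitive w k) :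
    IsPrimitive (fun t => u t - w t) (fun t => g t - k t) := by
  refine ⟨fun T hT => (hu.ac T hT).fun_sub (hw.ac T hT), ?_⟩
  filter_upwards [hu.ae_deriv, hw.ae_deriv] with t h1 h2 using h1.sub h2

theorem mul (hu : IsPrimitive u g) (hw : IsPrimitive w k) :
    IsPrimitive (fun t => u t * w t) (fun t => g t * w t + u t * k t) := by
  refine ⟨fun T hT => (hu.ac T hT).fun_mul (hw.ac T hT), ?_⟩
  filter_upwards [hu.ae_deriv, hw.ae_deriv] with t h1 h2 using h1.mul h2

theorem of_contDiff (hu : ContDiff ℝ 1 u) : IsPrimitive u (deriv u) :=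
  ⟨fun _ _ => hu.contDiffOn.absolutelyContinuousOnInterval,
    Filter.Eventually.of_forall fun t => (hu.differentiable one_ne_zero t).hasDerivAt⟩

theorem const (a : ℝ) : IsPrimitive (fun _ => a) (fun _ => 0) :=
  (of_contDiff contDiff_const).congr_deriv (by simp)

theorem exp_mul (a : ℝ) :
    IsPrimitive (fun t => Real.exp (a * t)) (fun t => a * Real.exp (a * t)) := by
  refine (of_contDiff (by fun_prop)).congr_deriv fun t _ => ?_
  have : HasDerivAt (fun t => Real.exp (a * t)) (Real.exp (a * t) * (a * 1)) t :=
    ((hasDerivAt_id t).const_mul a).exp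
  rw [this.deriv]; ring

theorem const_mul (hu : IsPrimitive u g) (a : ℝ) :
    IsPrimitive (fun t => a * u t) (fun t => a * g t) :=
  ((const a).mul hu).congr_deriv (by simp)

theorem inv (hu : IsPrimitive u g) (hpos : ∀ t, 0 ≤ t → 0 < u t) :
    IsPrimitive (fun t => (u t)⁻¹) (fun t => -g t / u t ^ 2) := by
  constructor
  · intro T hT
    have hc := (hu.ac T hT).continuousOn
    obtain ⟨m, hm, hmin⟩ := isCompact_uIcc.exists_isMinOn nonempty_uIcc hc
    rw [uIcc_of_le hT] at hm
    have h0 : 0 < u m := hpos m hm.1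
    refine (hu.ac T hT).of_dist_le (K := (u m ^ 2)⁻¹) (by positivity) fun x hx y hy => ?_
    have hx1 : u m ≤ u x := hmin hx
    have hy1 : u m ≤ u y := hmin hy
    have hx0 : 0 < u x := h0.trans_le hx1
    have hy0 : 0 < u y := h0.trans_le hy1
    rw [Real.dist_eq, Real.dist_eq, inv_sub_inv hx0.ne' hy0.ne', abs_div, abs_sub_comm,
      abs_of_pos (mul_pos hx0 hy0), div_eq_inv_mul]
    gcongr
    nlinarith
  · filter_upwards [hu.ae_deriv, ae_restrict_mem measurableSet_Ioi] with t h1 h0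
    exact h1.inv (hpos t (le_of_lt h0)).ne'

theorem ae_deriv_Ioc (hu : IsPrimitive u g) {a b : ℝ} (ha : 0 ≤ a) :
    ∀ᵐ t ∂volume.restrict (Ioc a b), deriv u t = g t := by
  filter_upwards [ae_restrict_of_ae_restrict_of_subset
    (fun t (ht : t ∈ Ioc a b) => show t ∈ Ioi (0 : ℝ) from ha.trans_lt ht.1) hu.ae_deriv]
    with t ht using ht.deriv

theorem intervalIntegrable (hu : IsPrimitive u g) {a b : ℝ} (ha : 0 ≤ a) (hab : a ≤ b) :
    IntervalIntegrable g volume a b := by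
  have h := ((hu.ac b (ha.trans hab)).mono (c := a) (d := b) (by
    rw [uIcc_of_le hab, uIcc_of_le (ha.trans hab)]
    exact Icc_subset_Icc_left ha)).intervalIntegrable_deriv
  refine h.congr_ae ?_
  rw [uIoc_of_le hab]
  exact hu.ae_deriv_Ioc ha

theorem integral_eq_sub (hu : IsPrimitive u g) {a b : ℝ} (ha : 0 ≤ a) (hab : a ≤ b) :
    ∫ t in a..b, g t = u b - u a := by
  have h := ((hu.ac b (ha.trans hab)).mono (c := a) (d := b) (by
    rw [uIcc_of_le hab, uIcc_of_le (ha.trans hab)]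
    exact Icc_subset_Icc_left ha)).integral_deriv_eq_sub
  rw [← h, intervalIntegral.integral_of_le hab, intervalIntegral.integral_of_le hab]
  refine integral_congr_ae ?_
  filter_upwards [hu.ae_deriv_Ioc ha] with t ht using ht.symm

theorem of_integral (hg : ∀ T, 0 ≤ T → IntervalIntegrable g volume 0 T)
    (hu : ∀ t, 0 ≤ t → u t = u 0 + ∫ s in (0 : ℝ)..t, g s) : IsPrimitive u g := by
  constructor
  · intro T hT
    refine ((hg T hT).absolutelyContinuousOnInterval_intervalIntegral
      left_mem_uIcc).of_dist_le zero_le_one fun x hx y hy => ?_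
    rw [uIcc_of_le hT] at hx hy
    rw [hu x hx.1, hu y hy.1, dist_add_left, one_mul]
  · have key : ∀ n : ℕ, ∀ᵐ t, t ∈ Ioo (0 : ℝ) n → HasDerivAt u (g t) t := by
      intro n
      filter_upwards [(hg n n.cast_nonneg).ae_hasDerivAt_integral] with t ht h0
      have hm : t ∈ uIcc (0 : ℝ) n := by rw [uIcc_of_le n.cast_nonneg]; exact ⟨h0.1.le, h0.2.le⟩
      refine ((ht hm 0 left_mem_uIcc).const_add (u 0)).congr_of_eventuallyEq ?_
      filter_upwards [Ioi_mem_nhds h0.1] with y hy using hu y (le_of_lt hy)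
    rw [ae_restrict_iff' measurableSet_Ioi]
    filter_upwards [ae_all_iff.2 key] with t ht h0
    obtain ⟨n, hn⟩ := exists_nat_gt t
    exact ht n ⟨h0, hn⟩

/-- Comparison principle: a primitive that cannot increase where it is positive stays
nonpositive. -/
theorem nonpos (hu : IsPrimitive u g) (h0 : u 0 ≤ 0) {T : ℝ} (hT : 0 ≤ T)
    (hg : ∀ t, 0 < t → t < T → 0 < u t → g t ≤ 0) : u T ≤ 0 := by
  by_contra! hpos
  have hc : ContinuousOn u (Icc 0 T) := hu.continuousOn.mono Icc_subset_Ici_self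
  have hS : IsCompact (Icc 0 T ∩ u ⁻¹' Iic 0) :=
    isCompact_Icc.of_isClosed_subset (hc.preimage_isClosed_of_isClosed isClosed_Icc isClosed_Iic)
      inter_subset_left
  -- `r` is the last time up to `T` with `u ≤ 0`. On `(r, T)` the function is positive, so it cannot
  -- have climbed from `u r ≤ 0` to `u T > 0`.
  obtain ⟨r, ⟨hr, hr0⟩, hmax⟩ := hS.exists_isGreatest ⟨0, ⟨le_rfl, hT⟩, h0⟩
  have hr0' : u r ≤ 0 := hr0
  have hI := hu.integral_eq_sub hr.1 hr.2
  have : ∫ t in r..T, g t ≤ 0 := by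
    rw [intervalIntegral.integral_of_le hr.2, integral_Ioc_eq_integral_Ioo]
    refine setIntegral_nonpos measurableSet_Ioo fun t ht => ?_
    refine hg t (hr.1.trans_lt ht.1) ht.2 ?_
    by_contra! hle
    exact absurd (hmax ⟨⟨hr.1.trans ht.1.le, ht.2.le⟩, hle⟩) (not_le.2 ht.1)
  linarith

end IsPrimitive

end InfoAcq

/-! ### Global Carathéodory solutions by a weighted contraction. -/

namespace InfoAcq

/-- Global solvability of an integral equation with bounded, globally Lipschitz, measurable
right-hand side. -/
theorem exists_integral_solution {F : ℝ → ℝ → ℝ} {L B : ℝ} (hL : 0 ≤ L)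
    (hLip : ∀ t x y, |F t x - F t y| ≤ L * |x - y|) (hB : ∀ t x, |F t x| ≤ B)
    (hmeas : ∀ u : ℝ → ℝ, Continuous u → Measurable fun t => F t (u t)) (x₀ : ℝ) :
    ∃ u : ℝ → ℝ, Continuous u ∧ ∀ t, 0 ≤ t → u t = x₀ + ∫ s in (0 : ℝ)..t, F s (u s) := by
  have hB0 : 0 ≤ B := (abs_nonneg _).trans (hB 0 0)
  -- The fixed point is sought for `e^{-Kt}` times the solution. `K > L` makes the map a contraction
  -- on the whole half-line at once, and `K ≥ 1` keeps it bounded although solutions may grow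
  -- linearly.
  set K : ℝ := L + 1 with hK
  have hK1 : 1 ≤ K := by linarith
  have hK0 : 0 < K := by linarith
  have hcont : ∀ u : BoundedContinuousFunction ℝ ℝ, Continuous fun s => Real.exp (K * s) * u s :=
    fun u => by fun_prop
  have hint : ∀ (u : BoundedContinuousFunction ℝ ℝ) (a b : ℝ),
      IntervalIntegrable (fun s => F s (Real.exp (K * s) * u s)) volume a b := fun u a b =>
    (intervalIntegrable_const (c := B)).mono_fun' (hmeas _ (hcont u)).aestronglyMeasurable
      (Filter.Eventually.of_forall fun s => hB _ _)
  -- Freezing negative times at `0` allows working with bounded functions on all of `ℝ`.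
  let φ : BoundedContinuousFunction ℝ ℝ → ℝ → ℝ := fun u t =>
    Real.exp (-(K * max t 0)) *
      (x₀ + ∫ s in (0 : ℝ)..max t 0, F s (Real.exp (K * s) * u s))
  have hφc : ∀ u, Continuous (φ u) := fun u => by
    have h1 := intervalIntegral.continuous_primitive (hint u) 0
    have h2 : Continuous fun t : ℝ => max t 0 := by fun_prop
    have h3 := h1.comp h2
    exact (by fun_prop : Continuous fun t : ℝ => Real.exp (-(K * max t 0))).mul
      (continuous_const.add h3)
  have hφb : ∀ u t, ‖φ u t‖ ≤ |x₀| + B := fun u t => by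
    set τ := max t 0
    have hτ : 0 ≤ τ := le_max_right _ _
    have h1 : ‖∫ s in (0 : ℝ)..τ, F s (Real.exp (K * s) * u s)‖ ≤ B * |τ - 0| :=
      intervalIntegral.norm_integral_le_of_norm_le_const fun s _ => hB _ _
    rw [Real.norm_eq_abs, sub_zero, abs_of_nonneg hτ] at h1
    have h2 : Real.exp (-(K * τ)) * (1 + τ) ≤ 1 := by
      rw [Real.exp_neg, inv_mul_le_iff₀ (Real.exp_pos _), mul_one]
      have := Real.add_one_le_exp (K * τ)
      nlinarith
    have h3 : Real.exp (-(K * τ)) > 0 := Real.exp_pos _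
    have h4 := abs_add_le x₀ (∫ s in (0 : ℝ)..τ, F s (Real.exp (K * s) * u s))
    change ‖Real.exp (-(K * τ)) * _‖ ≤ _
    rw [norm_mul, Real.norm_eq_abs, Real.norm_eq_abs, abs_of_pos h3]
    calc _ ≤ Real.exp (-(K * τ)) * ((|x₀| + B) * (1 + τ)) := by
          gcongr
          nlinarith [abs_nonneg x₀, mul_nonneg (abs_nonneg x₀) hτ]
      _ = (|x₀| + B) * (Real.exp (-(K * τ)) * (1 + τ)) := by ring
      _ ≤ (|x₀| + B) * 1 := by gcongr
      _ = _ := mul_one _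
  let Φ : BoundedContinuousFunction ℝ ℝ → BoundedContinuousFunction ℝ ℝ := fun u =>
    BoundedContinuousFunction.ofNormedAddCommGroup (φ u) (hφc u) _ (hφb u)
  have hΦ : ContractingWith (L / K).toNNReal Φ := by
    have hcoe : ((L / K).toNNReal : ℝ) = L / K := Real.coe_toNNReal _ (by positivity)
    refine ⟨?_, LipschitzWith.of_dist_le_mul fun u w => ?_⟩
    · rw [← NNReal.coe_lt_coe, hcoe]
      exact (div_lt_one hK0).2 (by linarith)
    rw [hcoe, BoundedContinuousFunction.dist_le (by positivity)]
    intro t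
    change dist (φ u t) (φ w t) ≤ L / K * dist u w
    set τ := max t 0
    have hτ : 0 ≤ τ := le_max_right _ _
    have h3 : Real.exp (-(K * τ)) > 0 := Real.exp_pos _
    have h1 : ‖∫ s in (0 : ℝ)..τ,
        (F s (Real.exp (K * s) * u s) - F s (Real.exp (K * s) * w s))‖ ≤
        ∫ s in (0 : ℝ)..τ, L * dist u w * Real.exp (K * s) := by
      refine intervalIntegral.norm_integral_le_of_norm_le hτ
        (Filter.Eventually.of_forall fun s _ => (hLip _ _ _).trans ?_)
        (Continuous.intervalIntegrable (by fun_prop) _ _)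
      rw [← mul_sub, abs_mul, abs_of_pos (Real.exp_pos _)]
      have := u.dist_coe_le_dist (g := w) s
      rw [Real.dist_eq] at this
      calc _ ≤ L * (Real.exp (K * s) * dist u w) := by gcongr
        _ = _ := by ring
    have h2 : ∫ s in (0 : ℝ)..τ, L * dist u w * Real.exp (K * s) =
        L * dist u w * ((Real.exp (K * τ) - 1) / K) := by
      rw [intervalIntegral.integral_const_mul, intervalIntegral.integral_comp_mul_left _ hK0.ne',
        integral_exp]
      simp [div_eq_inv_mul]
    have h4 : φ u t - φ w t = Real.exp (-(K * τ)) * ∫ s in (0 : ℝ)..τ,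
        (F s (Real.exp (K * s) * u s) - F s (Real.exp (K * s) * w s)) := by
      rw [intervalIntegral.integral_sub (hint u _ _) (hint w _ _)]
      change Real.exp (-(K * τ)) * _ - Real.exp (-(K * τ)) * _ = _
      ring
    rw [Real.dist_eq, h4, abs_mul, abs_of_pos h3]
    rw [h2, Real.norm_eq_abs] at h1
    have h5 : Real.exp (-(K * τ)) * Real.exp (K * τ) = 1 := by
      rw [← Real.exp_add]; simp
    calc _ ≤ Real.exp (-(K * τ)) * (L * dist u w * ((Real.exp (K * τ) - 1) / K)) := by gcongr
      _ = L / K * dist u w * (Real.exp (-(K * τ)) * Real.exp (K * τ) - Real.exp (-(K * τ))) := by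
          field
      _ ≤ L / K * dist u w * 1 := by
          have : 0 ≤ dist u w := dist_nonneg
          gcongr
          rw [h5]; linarith
      _ = _ := mul_one _
  obtain ⟨u, hu⟩ : ∃ u, Φ u = u := ⟨_, hΦ.fixedPoint_isFixedPt⟩
  refine ⟨fun t => Real.exp (K * t) * u t, hcont u, fun t ht => ?_⟩
  have h1 : u t = φ u t := by rw [← show Φ u t = φ u t from rfl, hu]
  change Real.exp (K * t) * u t = _
  rw [h1]
  change Real.exp (K * t) * (Real.exp (-(K * max t 0)) * _) = _
  rw [max_eq_left ht, ← mul_assoc, ← Real.exp_add]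
  simp

end InfoAcq

/-! ### Information cost, feedback map and controlled states. -/

namespace InfoAcq

namespace Model

/-- Standing assumptions on the model. -/
structure Standing (P : Model) : Prop where
  lam_nonneg : 0 ≤ P.lam
  σ₁_pos : 0 < P.σ₁
  σ₂_nonneg : 0 ≤ P.σ₂
  κ_pos : 0 < P.κ
  ρ_pos : 0 < P.ρ
  δ_pos : 0 < P.δ
  γinf_lt : P.γinf < P.γmax
  c_nonneg : ∀ x, 0 ≤ x → 0 ≤ P.c x
  c_convex : StrictConvexOn ℝ (Ici 0) P.c
  c_smooth : ContDiffOn ℝ 2 P.c (Ici 0)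
  c_mono : StrictMonoOn P.c (Ici 0)
  exists_dc : ∃ h, 0 ≤ h ∧ P.M₀ ≤ P.dc h

variable {P : Model}

theorem f_sub_f (a b h : ℝ) :
    P.f a h - P.f b h = -((P.sbar ^ 2 + h) * (a + b) + 2 * P.lam) * (a - b) := by
  unfold f; ring

theorem Admissible.nonneg {h : ℝ → ℝ} (hh : P.Admissible h) {t : ℝ}
    (ht : 0 ≤ t) : 0 ≤ h t := (hh.2 t ht).1

theorem Admissible.intervalIntegrable_drift {h γ : ℝ → ℝ}
    (hh : P.Admissible h) (hγ : ContinuousOn γ (Ici 0)) {T : ℝ} (hT : 0 ≤ T) :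
    IntervalIntegrable (fun t => P.f (γ t) (h t)) volume 0 T := by
  have hc : ContinuousOn γ (uIcc 0 T) := by
    rw [uIcc_of_le hT]; exact hγ.mono Icc_subset_Ici_self
  have h1 : IntervalIntegrable h volume 0 T := by
    refine (intervalIntegrable_const (c := P.hmax)).mono_fun' hh.1.aestronglyMeasurable ?_
    rw [uIoc_of_le hT]
    filter_upwards [ae_restrict_mem measurableSet_Ioc] with t ht
    have := hh.2 t ht.1.le
    rw [Real.norm_eq_abs, abs_of_nonneg this.1]
    exact this.2
  have h2 := h1.mul_continuousOn (hc.pow 2)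
  have h3 : IntervalIntegrable
      (fun t => -P.sbar ^ 2 * γ t ^ 2 - 2 * P.lam * γ t + P.σ₂ ^ 2) volume 0 T :=
    ContinuousOn.intervalIntegrable (by fun_prop)
  refine (h3.sub h2).congr fun t _ => ?_
  simp only [f, Pi.pow_apply]; ring

theorem IsState.isPrimitive {h γ : ℝ → ℝ} {γ₀ : ℝ} (hγ : P.IsState h γ₀ γ)
    (hh : P.Admissible h) : IsPrimitive γ fun t => P.f (γ t) (h t) := by
  have h0 : γ 0 = γ₀ := by simpa using hγ.2 0 le_rfl
  refine IsPrimitive.of_integral (fun T hT => hh.intervalIntegrable_drift hγ.1 hT) fun t ht => ?_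
  rw [h0]; exact hγ.2 t ht

theorem IsState.init {h γ : ℝ → ℝ} {γ₀ : ℝ} (hγ : P.IsState h γ₀ γ) :
    γ 0 = γ₀ := by simpa using hγ.2 0 le_rfl

namespace Standing

variable (hP : P.Standing)
include hP

theorem sbar_pos : 0 < P.sbar := one_div_pos.2 hP.σ₁_pos

theorem abar_pos : 0 < P.abar := by
  have hρ := hP.ρ_pos
  have hδ := hP.δ_pos
  have hl := hP.lam_nonneg
  have h1 : 0 < P.a₁ := by
    have : P.δ * P.ρ < √(P.δ ^ 2 * P.ρ ^ 2 + 4 * P.κ * P.ρ) := by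
      apply Real.lt_sqrt_of_sq_lt
      nlinarith [mul_pos hP.κ_pos hρ]
    unfold a₁; linarith
  have h3 : 0 < P.a₃ := by unfold a₃; positivity
  have h : P.abar = P.a₃ ^ 2 / (2 * P.ρ) := by
    have : 2 * P.lam + P.δ ≠ 0 := by positivity
    unfold abar a₂; field_simp; ring
  rw [h]; positivity

theorem differentiableOn_c : DifferentiableOn ℝ P.c (Ici 0) :=
  hP.c_smooth.differentiableOn (by norm_num)

theorem continuousOn_c : ContinuousOn P.c (Ici 0) := hP.differentiableOn_c.continuousOn

theorem continuousOn_dc : ContinuousOn P.dc (Ici 0) :=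
  hP.c_smooth.continuousOn_derivWithin (uniqueDiffOn_Ici 0) (by norm_num)

theorem strictMonoOn_dc : StrictMonoOn P.dc (Ici 0) :=
  hP.c_convex.strictMonoOn_derivWithin hP.differentiableOn_c

theorem tangent_le_c {h k : ℝ} (hh : 0 ≤ h) (hk : 0 ≤ k) : P.c k + P.dc k * (h - k) ≤ P.c h := by
  rcases lt_trichotomy h k with hlt | rfl | hlt
  · have := hP.c_convex.convexOn.slope_le_derivWithin (mem_Ici.2 hh) (mem_Ici.2 hk) hlt
      (hP.differentiableOn_c k hk)
    rw [slope_def_field, div_le_iff₀ (by linarith)] at this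
    change _ ≤ P.dc k * _ at this
    linarith
  · simp
  · have := hP.c_convex.convexOn.derivWithin_le_slope (mem_Ici.2 hk) (mem_Ici.2 hh) hlt
      (hP.differentiableOn_c k hk)
    rw [slope_def_field, le_div_iff₀ (by linarith)] at this
    change P.dc k * _ ≤ _ at this
    linarith

theorem dc_zero_nonneg : 0 ≤ P.dc 0 :=
  hP.c_mono.monotoneOn.derivWithin_nonneg

theorem exists_dc_eq {x : ℝ} (h0 : P.dc 0 ≤ x) (h1 : x ≤ P.M₀) : ∃ h ∈ Ici (0 : ℝ), P.dc h = x := by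
  obtain ⟨k, hk, hk'⟩ := hP.exists_dc
  obtain ⟨h, hh, e⟩ := intermediate_value_Icc hk (hP.continuousOn_dc.mono Icc_subset_Ici_self)
    ⟨h0, h1.trans hk'⟩
  exact ⟨h, hh.1, e⟩

theorem hhat_dc {h : ℝ} (hh : 0 ≤ h) : P.hhat (P.dc h) = h := by
  have : ¬ P.dc h < P.dc 0 :=
    not_lt.2 (hP.strictMonoOn_dc.monotoneOn (mem_Ici.2 le_rfl) (mem_Ici.2 hh) hh)
  rw [hhat, if_neg this]
  exact hP.strictMonoOn_dc.injOn.leftInvOn_invFunOn (mem_Ici.2 hh)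

theorem hhat_of_le {x : ℝ} (hx : x ≤ P.dc 0) : P.hhat x = 0 := by
  rcases hx.lt_or_eq with h | rfl
  · rw [hhat, if_pos h]
  · exact hP.hhat_dc le_rfl

theorem hhat_spec {x : ℝ} (h0 : P.dc 0 ≤ x) (h1 : x ≤ P.M₀) :
    0 ≤ P.hhat x ∧ P.dc (P.hhat x) = x := by
  obtain ⟨h, hh, rfl⟩ := hP.exists_dc_eq h0 h1
  rw [hP.hhat_dc hh]; exact ⟨hh, rfl⟩

theorem hhat_nonneg {x : ℝ} (h1 : x ≤ P.M₀) : 0 ≤ P.hhat x := by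
  rcases le_total x (P.dc 0) with h | h
  · exact (hP.hhat_of_le h).ge
  · exact (hP.hhat_spec h h1).1

theorem hhat_mono {x y : ℝ} (hxy : x ≤ y) (hy : y ≤ P.M₀) : P.hhat x ≤ P.hhat y := by
  rcases le_total x (P.dc 0) with h | h
  · rw [hP.hhat_of_le h]; exact hP.hhat_nonneg hy
  · have h1 := hP.hhat_spec h (hxy.trans hy)
    have h2 := hP.hhat_spec (h.trans hxy) hy
    refine (hP.strictMonoOn_dc.le_iff_le (mem_Ici.2 h1.1) (mem_Ici.2 h2.1)).1 ?_
    rwa [h1.2, h2.2]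

theorem hmax_nonneg : 0 ≤ P.hmax := hP.hhat_nonneg le_rfl

omit hP in
theorem admissible_const {h : ℝ} (h0 : 0 ≤ h) (h1 : h ≤ P.hmax) : P.Admissible fun _ => h :=
  ⟨measurable_const, fun _ _ => ⟨h0, h1⟩⟩

theorem state_nonneg {h γ : ℝ → ℝ} {γ₀ : ℝ} (h0 : 0 ≤ γ₀) (hh : P.Admissible h)
    (hγ : P.IsState h γ₀ γ) {T : ℝ} (hT : 0 ≤ T) : 0 ≤ γ T := by
  obtain ⟨B, hB⟩ := isCompact_Icc.exists_bound_of_continuousOn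
    (hγ.1.mono (Icc_subset_Ici_self : Icc 0 T ⊆ Ici 0))
  -- Where `γ < 0`, the bound `|γ| ≤ B` gives `f ≥ Kγ`, so `e^{-Kt}γ` cannot decrease there.
  set K := (P.sbar ^ 2 + P.hmax) * B with hK
  have hd := ((IsPrimitive.exp_mul (-K)).mul (hγ.isPrimitive hh)).const_mul (-1)
  have := hd.nonpos (T := T) (by simpa [hγ.init] using h0) hT fun t ht htT hpos => by
    have hE := Real.exp_pos (-K * t)
    have hneg : γ t < 0 := by nlinarith
    have hBt := hB t ⟨ht.le, htT.le⟩
    rw [Real.norm_eq_abs, abs_of_neg hneg] at hBt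
    have hht := hh.2 t ht.le
    have h1 : (P.sbar ^ 2 + h t) * (-γ t) ≤ K :=
      mul_le_mul (by linarith [hht.2]) hBt (by linarith)
        (by have := hP.hmax_nonneg; positivity)
    have h2 : 0 ≤ P.f (γ t) (h t) - K * γ t := by
      have h3 := mul_nonneg (sub_nonneg.2 h1) (neg_nonneg.2 hneg.le)
      have h4 := mul_nonneg hP.lam_nonneg (neg_nonneg.2 hneg.le)
      unfold f; nlinarith [sq_nonneg P.σ₂]
    nlinarith
  have hE := Real.exp_pos (-K * T)
  by_contra! hneg
  nlinarith

/-- Upper bound for states started at `γ₀`. -/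
theorem state_le {h γ : ℝ → ℝ} {γ₀ : ℝ} (h0 : 0 ≤ γ₀) (hh : P.Admissible h)
    (hγ : P.IsState h γ₀ γ) {T : ℝ} (hT : 0 ≤ T) : γ T ≤ γ₀ + P.σ₂ * P.σ₁ := by
  have hs : P.sbar * P.σ₁ = 1 := by rw [sbar, one_div_mul_cancel hP.σ₁_pos.ne']
  have hR : 0 ≤ P.σ₂ * P.σ₁ := mul_nonneg hP.σ₂_nonneg hP.σ₁_pos.le
  have hd := (hγ.isPrimitive hh).sub (IsPrimitive.const (γ₀ + P.σ₂ * P.σ₁))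
  have := hd.nonpos (T := T) (by simp only [hγ.init]; linarith) hT fun t ht _ hpos => by
    have h1 : P.σ₂ ≤ P.sbar * γ t := by
      have : P.sbar * (P.σ₂ * P.σ₁) ≤ P.sbar * γ t := by
        have := hP.sbar_pos
        gcongr; linarith
      calc P.σ₂ = P.σ₂ * (P.sbar * P.σ₁) := by rw [hs, mul_one]
        _ ≤ _ := by linarith
    have h2 : P.σ₂ ^ 2 ≤ (P.sbar * γ t) ^ 2 := pow_le_pow_left₀ hP.σ₂_nonneg h1 2
    have h3 := mul_nonneg (hh.nonneg ht.le) (sq_nonneg (γ t))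
    have h4 := mul_nonneg hP.lam_nonneg (show 0 ≤ γ t by linarith)
    unfold f; nlinarith
  linarith

theorem state_pos {h γ : ℝ → ℝ} {γ₀ : ℝ} (h0 : 0 < γ₀) (hh : P.Admissible h)
    (hγ : P.IsState h γ₀ γ) {T : ℝ} (hT : 0 ≤ T) : 0 < γ T := by
  set R := γ₀ + P.σ₂ * P.σ₁
  -- With `0 ≤ γ ≤ R` this gives `f ≥ -Kγ`, so `γ₀e^{-Kt}` is a lower barrier.
  set K := (P.sbar ^ 2 + P.hmax) * R + 2 * P.lam with hK
  have hd := ((IsPrimitive.exp_mul (-K)).const_mul γ₀).sub (hγ.isPrimitive hh)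
  have := hd.nonpos (T := T) (by simp [hγ.init]) hT fun t ht _ hpos => by
    have hn := hP.state_nonneg h0.le hh hγ ht.le
    have hle := hP.state_le h0.le hh hγ ht.le
    have hht := hh.2 t ht.le
    have hm := hP.hmax_nonneg
    have hl := hP.lam_nonneg
    have h1 : (P.sbar ^ 2 + h t) * γ t + 2 * P.lam ≤ K := by
      rw [hK]; gcongr; exact hht.2
    have h2 : -K * γ t ≤ P.f (γ t) (h t) := by
      have := mul_nonneg (sub_nonneg.2 h1) hn
      unfold f; nlinarith [sq_nonneg P.σ₂]
    have hK0 : 0 ≤ K := (by have := hht.1; positivity : (0 : ℝ) ≤ _).trans h1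
    nlinarith
  have hE := Real.exp_pos (-K * T)
  nlinarith [mul_pos h0 hE]

theorem exists_state {h : ℝ → ℝ} (hh : P.Admissible h) {γ₀ : ℝ} (h0 : 0 ≤ γ₀) :
    ∃ γ, P.IsState h γ₀ γ := by
  set R := γ₀ + P.σ₂ * P.σ₁ with hR
  have hσ : 0 ≤ P.σ₂ * P.σ₁ := mul_nonneg hP.σ₂_nonneg hP.σ₁_pos.le
  have hR0 : 0 ≤ R := by positivity
  have hs := hP.sbar_pos
  have hl := hP.lam_nonneg
  have hm := hP.hmax_nonneg
  -- The quadratic drift is only locally Lipschitz, so the state is truncated to `[0, R]`. The drift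
  -- is nonnegative at `0` and nonpositive at `R ≥ σ₁σ₂`, so the solution never leaves this interval
  -- and the truncation is inactive.
  set q : ℝ → ℝ := fun x => max 0 (min x R)
  set k : ℝ → ℝ := fun t => h (max t 0)
  have hq0 : ∀ x, 0 ≤ q x := fun x => le_max_left _ _
  have hqR : ∀ x, q x ≤ R := fun x => max_le hR0 (min_le_right _ _)
  have hqL : ∀ x y, |q x - q y| ≤ |x - y| := fun x y => by
    refine (abs_max_sub_max_le_max _ _ _ _).trans ?_
    refine (max_le (by simp) ((abs_min_sub_min_le_max _ _ _ _).trans ?_))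
    simp
  have hqc : Continuous q := by fun_prop
  have hk : ∀ t, k t ∈ Icc 0 P.hmax := fun t => hh.2 _ (le_max_right _ _)
  have hkm : Measurable k := hh.1.comp (measurable_id.max measurable_const)
  have habs : ∀ t a b, |-((P.sbar ^ 2 + k t) * (q a + q b) + 2 * P.lam)| ≤
      (P.sbar ^ 2 + P.hmax) * (R + R) + 2 * P.lam := fun t a b => by
    have h1 := hq0 a
    have h2 := hq0 b
    have h3 := (hk t).1
    rw [abs_neg, abs_of_nonneg (by positivity)]
    gcongr
    exacts [(hk t).2, hqR a, hqR b]
  obtain ⟨u, huc, hu⟩ := exists_integral_solution (F := fun t x => P.f (q x) (k t))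
    (L := (P.sbar ^ 2 + P.hmax) * (R + R) + 2 * P.lam)
    (B := ((P.sbar ^ 2 + P.hmax) * (R + R) + 2 * P.lam) * R + P.σ₂ ^ 2) (by positivity)
    (fun t x y => by
      rw [f_sub_f, abs_mul]
      exact mul_le_mul (habs t x y) (hqL x y) (abs_nonneg _) (by positivity))
    (fun t x => by
      have e : P.f (q x) (k t) = P.f (q x) (k t) - P.f (q 0) (k t) + P.σ₂ ^ 2 := by
        have : q 0 = 0 := by simp [q, hR0]
        rw [this]; unfold f; ring
      rw [e]
      refine (abs_add_le _ _).trans (add_le_add ?_ (abs_of_nonneg (by positivity)).le)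
      have : q 0 = 0 := by simp [q, hR0]
      rw [f_sub_f, abs_mul]
      refine mul_le_mul (habs t x 0) ?_ (abs_nonneg _) (by positivity)
      rw [this, sub_zero, abs_of_nonneg (hq0 x)]
      exact hqR x)
    (fun v hv => by
      have h1 : Measurable fun t => q (v t) := (hqc.comp hv).measurable
      unfold f; fun_prop) γ₀
  have hu0 : u 0 = γ₀ := by simpa using hu 0 le_rfl
  have hprim : IsPrimitive u fun t => P.f (q (u t)) (k t) := by
    refine IsPrimitive.of_integral (fun T hT => ?_) (by rw [hu0]; exact hu)
    have hk' : P.Admissible k := ⟨hkm, fun t _ => hk t⟩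
    exact hk'.intervalIntegrable_drift (hqc.comp huc).continuousOn hT
  have hun : ∀ T, 0 ≤ T → 0 ≤ u T := fun T hT => by
    have := (hprim.const_mul (-1)).nonpos (T := T) (by simp [hu0, h0]) hT fun t ht _ hpos => by
      have : q (u t) = 0 := by
        have : u t ≤ R := by linarith
        simp only [q, min_eq_left this]
        exact max_eq_left (by linarith)
      rw [this]; unfold f; nlinarith [sq_nonneg P.σ₂]
    linarith
  have huR : ∀ T, 0 ≤ T → u T ≤ R := fun T hT => by
    have := (hprim.sub (IsPrimitive.const R)).nonpos (T := T) (by simp only [hu0]; linarith) hT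
      fun t ht _ hpos => by
        have e : q (u t) = R := by
          simp only [q, min_eq_right (show R ≤ u t by linarith), max_eq_right hR0]
        have h1 : P.σ₂ ≤ P.sbar * R := by
          have : P.sbar * P.σ₁ = 1 := by rw [sbar, one_div_mul_cancel hP.σ₁_pos.ne']
          calc P.σ₂ = P.σ₂ * (P.sbar * P.σ₁) := by rw [this, mul_one]
            _ ≤ _ := by rw [hR]; nlinarith [mul_nonneg hs.le h0]
        have h2 : P.σ₂ ^ 2 ≤ (P.sbar * R) ^ 2 := pow_le_pow_left₀ hP.σ₂_nonneg h1 2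
        have h3 := mul_nonneg (hk t).1 (sq_nonneg R)
        have h4 := mul_nonneg hl hR0
        rw [e]; unfold f; nlinarith
    linarith
  refine ⟨u, huc.continuousOn, fun t ht => ?_⟩
  rw [hu t ht]
  congr 1
  refine intervalIntegral.integral_congr fun s hs => ?_
  rw [uIcc_of_le ht] at hs
  have e1 : q (u s) = u s := by
    simp only [q, min_eq_left (huR s hs.1), max_eq_right (hun s hs.1)]
  have e2 : k s = h s := by simp only [k, max_eq_left hs.1]
  simp only [e1, e2]

/-- Drift inequality for ordered nonnegative states. -/
theorem f_le_f {a b h : ℝ} (hb : 0 ≤ b) (hba : b ≤ a) (hh : 0 ≤ h) : P.f a h ≤ P.f b h := by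
  have h1 := f_sub_f (P := P) a b h
  have h2 : 0 ≤ ((P.sbar ^ 2 + h) * (a + b) + 2 * P.lam) * (a - b) := by
    have := hP.lam_nonneg
    have : 0 ≤ a := hb.trans hba
    exact mul_nonneg (by positivity) (by linarith)
  linarith

theorem state_mono {h γ₁ γ₂ : ℝ → ℝ} {a b : ℝ} (hb : 0 ≤ b) (hba : b ≤ a) (hh : P.Admissible h)
    (h₁ : P.IsState h a γ₁) (h₂ : P.IsState h b γ₂) {T : ℝ} (hT : 0 ≤ T) : γ₂ T ≤ γ₁ T := by
  have := ((h₂.isPrimitive hh).sub (h₁.isPrimitive hh)).nonpos (T := T)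
    (by simp [h₁.init, h₂.init, hba]) hT fun t ht _ hpos => by
      have := hP.f_le_f (hP.state_nonneg (hb.trans hba) hh h₁ ht.le)
        (show γ₁ t ≤ γ₂ t by linarith) (hh.nonneg ht.le)
      linarith
  linarith

/-- The drift decreases in the state, so two ordered solutions under one control can only approach
each other. -/
theorem state_sub_le {h γ₁ γ₂ : ℝ → ℝ} {a b : ℝ} (hb : 0 ≤ b) (hba : b ≤ a)
    (hh : P.Admissible h) (h₁ : P.IsState h a γ₁) (h₂ : P.IsState h b γ₂) {T : ℝ} (hT : 0 ≤ T) :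
    γ₁ T - γ₂ T ≤ a - b := by
  have := (((h₁.isPrimitive hh).sub (h₂.isPrimitive hh)).sub (IsPrimitive.const (a - b))).nonpos
    (T := T) (by simp [h₁.init, h₂.init]) hT fun t ht _ hpos => by
      have := hP.f_le_f (hP.state_nonneg hb hh h₂ ht.le) (hP.state_mono hb hba hh h₁ h₂ ht.le)
        (hh.nonneg ht.le)
      linarith
  linarith

/-- The drift is concave in the state, so the mixture of two solutions is a subsolution for the
mixed initial value. -/
theorem state_concave {h γ₁ γ₂ γ : ℝ → ℝ} {a b θ η : ℝ} (ha : 0 ≤ a) (hb : 0 ≤ b) (hθ : 0 ≤ θ)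
    (hη : 0 ≤ η) (hθη : θ + η = 1) (hh : P.Admissible h) (h₁ : P.IsState h a γ₁)
    (h₂ : P.IsState h b γ₂) (hγ : P.IsState h (θ * a + η * b) γ) {T : ℝ} (hT : 0 ≤ T) :
    θ * γ₁ T + η * γ₂ T ≤ γ T := by
  have := ((((h₁.isPrimitive hh).const_mul θ).add ((h₂.isPrimitive hh).const_mul η)).sub
    (hγ.isPrimitive hh)).nonpos
    (T := T) (by simp [h₁.init, h₂.init, hγ.init]) hT fun t ht _ hpos => by
      have hle := hP.f_le_f (hP.state_nonneg (by positivity) hh hγ ht.le)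
        (show γ t ≤ θ * γ₁ t + η * γ₂ t by linarith) (hh.nonneg ht.le)
      have hconc : θ * P.f (γ₁ t) (h t) + η * P.f (γ₂ t) (h t) ≤
          P.f (θ * γ₁ t + η * γ₂ t) (h t) := by
        have e : P.f (θ * γ₁ t + η * γ₂ t) (h t) -
            (θ * P.f (γ₁ t) (h t) + η * P.f (γ₂ t) (h t)) =
            (P.sbar ^ 2 + h t) * (θ * η * (γ₁ t - γ₂ t) ^ 2) := by
          obtain rfl : η = 1 - θ := by linarith
          unfold f; ring
        have := hh.nonneg ht.le
        have : 0 ≤ (P.sbar ^ 2 + h t) * (θ * η * (γ₁ t - γ₂ t) ^ 2) := by positivity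
        linarith
      linarith
  linarith

/-- Mixing controls and initial precisions mixes the precisions from below. -/
theorem state_le_harmonic {h₁ h₂ γ₁ γ₂ γ : ℝ → ℝ} {a b θ η : ℝ} (ha : 0 < a) (hb : 0 < b)
    (hθ : 0 ≤ θ) (hη : 0 ≤ η) (hθη : θ + η = 1) (hh₁ : P.Admissible h₁) (hh₂ : P.Admissible h₂)
    (hh : P.Admissible fun t => θ * h₁ t + η * h₂ t)
    (hγ₁ : P.IsState h₁ a γ₁) (hγ₂ : P.IsState h₂ b γ₂)
    (hγ : P.IsState (fun t => θ * h₁ t + η * h₂ t) (θ * a⁻¹ + η * b⁻¹)⁻¹ γ) {T : ℝ} (hT : 0 ≤ T) :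
    γ T ≤ (θ * (γ₁ T)⁻¹ + η * (γ₂ T)⁻¹)⁻¹ := by
  have p₁ : ∀ t, 0 ≤ t → 0 < γ₁ t := fun t => hP.state_pos ha hh₁ hγ₁
  have p₂ : ∀ t, 0 ≤ t → 0 < γ₂ t := fun t => hP.state_pos hb hh₂ hγ₂
  have hmix : ∀ x y : ℝ, 0 < x → 0 < y → 0 < θ * x + η * y := fun x y hx hy => by
    rcases hθ.eq_or_lt with rfl | h
    · have : η = 1 := by linarith
      subst this; simpa using hy
    · positivity
  have hq := ((((hγ₁.isPrimitive hh₁).inv p₁).const_mul θ).add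
    (((hγ₂.isPrimitive hh₂).inv p₂).const_mul η)).inv
    fun t ht => hmix _ _ (inv_pos.2 (p₁ t ht)) (inv_pos.2 (p₂ t ht))
  have := ((hγ.isPrimitive hh).sub hq).nonpos (T := T)
    (by simp [hγ₁.init, hγ₂.init, hγ.init]) hT fun t ht _ hpos => by
      have h1 := p₁ t ht.le
      have h2 := p₂ t ht.le
      have k1 := hh₁.nonneg ht.le
      have k2 := hh₂.nonneg ht.le
      have hi1 := inv_pos.2 h1
      have hi2 := inv_pos.2 h2
      have hw := hmix _ _ hi1 hi2
      have hle := hP.f_le_f (inv_pos.2 hw).le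
        (show (θ * (γ₁ t)⁻¹ + η * (γ₂ t)⁻¹)⁻¹ ≤ γ t by linarith) (hh.nonneg ht.le)
      -- Drift of the precision. Its concavity makes the mixed precisions a subsolution, but the
      -- comparison is run for the inverse, since it is in `γ` that the drift is decreasing.
      have inner : ∀ x k : ℝ, 0 < x → -P.f x k / x ^ 2 =
          P.sbar ^ 2 + k + 2 * P.lam * x⁻¹ - P.σ₂ ^ 2 * x⁻¹ ^ 2 := fun x k hx => by
        unfold f; field_simp; ring
      have outer : ∀ p k : ℝ, 0 < p → P.f p⁻¹ k =
          -(P.sbar ^ 2 + k + 2 * P.lam * p - P.σ₂ ^ 2 * p ^ 2) / p ^ 2 := fun p k hp => by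
        unfold f; field_simp; ring
      have hkey : P.f (θ * (γ₁ t)⁻¹ + η * (γ₂ t)⁻¹)⁻¹ (θ * h₁ t + η * h₂ t) ≤
          -(θ * (-P.f (γ₁ t) (h₁ t) / γ₁ t ^ 2) + η * (-P.f (γ₂ t) (h₂ t) / γ₂ t ^ 2)) /
            (θ * (γ₁ t)⁻¹ + η * (γ₂ t)⁻¹) ^ 2 := by
        rw [outer _ _ hw, inner _ _ h1, inner _ _ h2]
        generalize (γ₁ t)⁻¹ = x at *
        generalize (γ₂ t)⁻¹ = y at *
        refine div_le_div_of_nonneg_right ?_ (by positivity)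
        have : 0 ≤ P.σ₂ ^ 2 * (θ * η * (x - y) ^ 2) := by positivity
        obtain rfl : η = 1 - θ := by linarith
        nlinarith
      linarith
  linarith

end Standing

end Model

end InfoAcq

/-! ### Regularity of the value function. -/

namespace InfoAcq

theorem hasDerivAt_of_sandwich {v l u : ℝ → ℝ} {x m : ℝ} (hl : HasDerivAt l m x)
    (hu : HasDerivAt u m x) (hlx : l x = v x) (hux : u x = v x)
    (h : ∀ᶠ y in nhds x, l y ≤ v y ∧ v y ≤ u y) : HasDerivAt v m x := by
  rw [hasDerivAt_iff_isLittleO] at *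
  have h2 := hl.norm_left.add hu.norm_left
  refine (Asymptotics.IsBigO.of_bound 1 ?_).trans_isLittleO h2
  filter_upwards [h] with y hy
  rw [hlx, hux]
  simp only [smul_eq_mul, one_mul, Real.norm_eq_abs]
  rw [abs_of_nonneg (a := |_| + |_|) (by positivity)]
  have h3 := neg_abs_le (l y - v x - (y - x) * m)
  have h4 := le_abs_self (u y - v x - (y - x) * m)
  have h5 := abs_nonneg (l y - v x - (y - x) * m)
  have h6 := abs_nonneg (u y - v x - (y - x) * m)
  exact abs_le.2 ⟨by linarith, by linarith⟩

theorem _root_.ConvexOn.exists_affine_support {s : Set ℝ} {g : ℝ → ℝ} (hg : ConvexOn ℝ s g) {x : ℝ}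
    (hx : x ∈ interior s) : ∃ m, ∀ y ∈ s, g x + m * (y - x) ≤ g y := by
  refine ⟨derivWithin g (Ioi x) x, fun y hy => ?_⟩
  rcases lt_trichotomy y x with h | rfl | h
  · have h1 := (hg.slope_le_leftDeriv_of_mem_interior hy hx h).trans
      (hg.leftDeriv_le_rightDeriv_of_mem_interior hx)
    rw [slope_def_field, div_le_iff₀ (by linarith)] at h1
    linarith
  · simp
  · have h1 := hg.rightDeriv_le_slope_of_mem_interior hx hy h
    rw [slope_def_field, le_div_iff₀ (by linarith)] at h1
    linarith

namespace Model

namespace Standing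

variable {P : Model} (hP : P.Standing)
include hP

theorem integrableOn_exp : IntegrableOn (fun t => Real.exp (-P.δ * t)) (Ioi 0) :=
  integrableOn_exp_mul_Ioi (by linarith [hP.δ_pos]) 0

theorem integral_exp : ∫ t in Ioi (0 : ℝ), Real.exp (-P.δ * t) = 1 / P.δ := by
  rw [integral_exp_mul_Ioi (by linarith [hP.δ_pos])]
  simp

theorem running_nonneg {h γ : ℝ → ℝ} {γ₀ : ℝ} (h0 : 0 ≤ γ₀) (hh : P.Admissible h)
    (hγ : P.IsState h γ₀ γ) {t : ℝ} (ht : 0 ≤ t) :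
    0 ≤ Real.exp (-P.δ * t) * (P.abar * γ t + P.c (h t)) := by
  have h1 := hP.state_nonneg h0 hh hγ ht
  have h2 := hP.c_nonneg _ (hh.nonneg ht)
  have := hP.abar_pos
  positivity

theorem integrableOn_running {h γ : ℝ → ℝ} {γ₀ : ℝ} (h0 : 0 ≤ γ₀) (hh : P.Admissible h)
    (hγ : P.IsState h γ₀ γ) :
    IntegrableOn (fun t => Real.exp (-P.δ * t) * (P.abar * γ t + P.c (h t))) (Ioi 0) := by
  have ha := hP.abar_pos
  refine Integrable.mono' (g := fun t => (P.abar * (γ₀ + P.σ₂ * P.σ₁) + P.c P.hmax) *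
    Real.exp (-P.δ * t)) (hP.integrableOn_exp.const_mul _) ?_ ?_
  · have h1 : AEStronglyMeasurable γ (volume.restrict (Ioi 0)) :=
      (hγ.1.mono Ioi_subset_Ici_self).aestronglyMeasurable measurableSet_Ioi
    -- `c` is unconstrained on negative arguments; composing with `max x 0` gives a continuous
    -- function that agrees with it along the control.
    have h2 : Continuous fun x => P.c (max x 0) :=
      hP.continuousOn_c.comp_continuous (by fun_prop) fun x => mem_Ici.2 (le_max_right _ _)
    have h3 : AEStronglyMeasurable (fun t => P.c (h t)) (volume.restrict (Ioi 0)) := by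
      refine (h2.measurable.comp hh.1).aestronglyMeasurable.congr ?_
      filter_upwards [ae_restrict_mem measurableSet_Ioi] with t ht
      simp [max_eq_left (hh.nonneg (le_of_lt ht))]
    exact (by fun_prop : Continuous fun t => Real.exp (-P.δ * t)).aestronglyMeasurable.mul
      ((h1.const_mul _).add h3)
  · filter_upwards [ae_restrict_mem measurableSet_Ioi] with t ht
    have ht' : 0 ≤ t := le_of_lt ht
    rw [Real.norm_eq_abs, abs_of_nonneg (hP.running_nonneg h0 hh hγ ht'), mul_comm]
    have h1 := hP.state_le h0 hh hγ ht'
    have h2 := hP.c_mono.monotoneOn (mem_Ici.2 (hh.nonneg ht')) (mem_Ici.2 hP.hmax_nonneg)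
      (hh.2 t ht').2
    gcongr

theorem cost_nonneg {h γ : ℝ → ℝ} {γ₀ : ℝ} (h0 : 0 ≤ γ₀) (hh : P.Admissible h)
    (hγ : P.IsState h γ₀ γ) : 0 ≤ P.cost h γ :=
  setIntegral_nonneg measurableSet_Ioi fun _ ht => hP.running_nonneg h0 hh hγ (le_of_lt ht)

theorem v_le {h γ : ℝ → ℝ} {γ₀ : ℝ} (h0 : 0 ≤ γ₀) (hh : P.Admissible h)
    (hγ : P.IsState h γ₀ γ) : P.v γ₀ ≤ P.cost h γ :=
  csInf_le ⟨0, by rintro _ ⟨h, γ, hh, hγ, rfl⟩; exact hP.cost_nonneg h0 hh hγ⟩ ⟨h, γ, hh, hγ, rfl⟩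

theorem costs_nonempty {γ₀ : ℝ} (h0 : 0 ≤ γ₀) :
    {J | ∃ h γ : ℝ → ℝ, P.Admissible h ∧ P.IsState h γ₀ γ ∧ J = P.cost h γ}.Nonempty := by
  have hh := admissible_const le_rfl hP.hmax_nonneg
  obtain ⟨γ, hγ⟩ := hP.exists_state hh h0
  exact ⟨_, _, γ, hh, hγ, rfl⟩

theorem le_v {γ₀ k : ℝ} (h0 : 0 ≤ γ₀)
    (H : ∀ h γ : ℝ → ℝ, P.Admissible h → P.IsState h γ₀ γ → k ≤ P.cost h γ) : k ≤ P.v γ₀ :=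
  le_csInf (hP.costs_nonempty h0) (by rintro _ ⟨h, γ, hh, hγ, rfl⟩; exact H h γ hh hγ)

theorem exists_cost_lt {γ₀ ε : ℝ} (h0 : 0 ≤ γ₀) (hε : 0 < ε) :
    ∃ h γ : ℝ → ℝ, P.Admissible h ∧ P.IsState h γ₀ γ ∧ P.cost h γ < P.v γ₀ + ε := by
  obtain ⟨_, ⟨h, γ, hh, hγ, rfl⟩, hlt⟩ := exists_lt_of_csInf_lt (hP.costs_nonempty h0)
    (show P.v γ₀ < P.v γ₀ + ε by linarith)
  exact ⟨h, γ, hh, hγ, hlt⟩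

/-- Reusing from `a` a control chosen for `b` costs at most `ā(a - b)` extra per unit of time, by
`state_sub_le`, and discounting integrates this to `ā(a - b)/δ`. -/
theorem v_sub_le {a b : ℝ} (hb : 0 ≤ b) (hba : b ≤ a) : P.v a - P.v b ≤ P.abar / P.δ * (a - b) := by
  suffices P.v a - P.abar / P.δ * (a - b) ≤ P.v b by linarith
  refine hP.le_v hb fun h γ hh hγ => ?_
  have ha := hb.trans hba
  obtain ⟨γ', hγ'⟩ := hP.exists_state hh ha
  refine (sub_le_sub_right (hP.v_le ha hh hγ') _).trans ?_
  have e : P.abar / P.δ * (a - b) =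
      ∫ t in Ioi (0 : ℝ), P.abar * (a - b) * Real.exp (-P.δ * t) := by
    rw [integral_const_mul, hP.integral_exp]; ring
  rw [e, cost, cost, ← integral_sub (hP.integrableOn_running ha hh hγ')
    (hP.integrableOn_exp.const_mul _)]
  refine setIntegral_mono_on ((hP.integrableOn_running ha hh hγ').sub
    (hP.integrableOn_exp.const_mul _)) (hP.integrableOn_running hb hh hγ) measurableSet_Ioi
    fun t ht => ?_
  have h1 := hP.state_sub_le hb hba hh hγ' hγ (le_of_lt ht)
  have h2 := mul_le_mul_of_nonneg_left (mul_le_mul_of_nonneg_left h1 hP.abar_pos.le)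
    (Real.exp_pos (-P.δ * t)).le
  linarith

theorem concaveOn_v : ConcaveOn ℝ (Ici 0) P.v := by
  refine ⟨convex_Ici 0, fun a ha b hb θ η hθ hη hθη => ?_⟩
  have ha' : (0 : ℝ) ≤ a := ha
  have hb' : (0 : ℝ) ≤ b := hb
  simp only [smul_eq_mul]
  refine hP.le_v (by positivity) fun h γ hh hγ => ?_
  obtain ⟨γ₁, h₁⟩ := hP.exists_state hh ha'
  obtain ⟨γ₂, h₂⟩ := hP.exists_state hh hb'
  have I1 := (hP.integrableOn_running ha' hh h₁).const_mul θ
  have I2 := (hP.integrableOn_running hb' hh h₂).const_mul η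
  calc θ * P.v a + η * P.v b ≤ θ * P.cost h γ₁ + η * P.cost h γ₂ := by
        gcongr
        exacts [hP.v_le ha' hh h₁, hP.v_le hb' hh h₂]
    _ ≤ _ := by
        rw [cost, cost, ← integral_const_mul, ← integral_const_mul, ← integral_add I1 I2]
        refine setIntegral_mono_on (I1.add I2) (hP.integrableOn_running (by positivity) hh hγ)
          measurableSet_Ioi fun t ht => ?_
        have h3 := hP.state_concave ha' hb' hθ hη hθη hh h₁ h₂ hγ (le_of_lt ht)
        have h4 := mul_le_mul_of_nonneg_left (mul_le_mul_of_nonneg_left h3 hP.abar_pos.le)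
          (Real.exp_pos (-P.δ * t)).le
        obtain rfl : η = 1 - θ := by linarith
        linarith

/-- Minimizers are not known to exist, so `ε`-optimal controls are mixed. The mixed control is at
least as good as the mixed costs: by `state_le_harmonic` its state lies below the weighted harmonic
mean, hence below the arithmetic mean, and `c` is convex. -/
theorem convexOn_vcheck : ConvexOn ℝ (Ioi 0) P.vcheck := by
  refine ⟨convex_Ioi 0, fun a ha b hb θ η hθ hη hθη => ?_⟩
  have hm : 0 < θ * a + η * b := by simpa using convex_Ioi (0 : ℝ) ha hb hθ hη hθη
  have ha' : 0 < a⁻¹ := inv_pos.2 ha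
  have hb' : 0 < b⁻¹ := inv_pos.2 hb
  simp only [smul_eq_mul, vcheck, one_div]
  refine le_of_forall_pos_le_add fun ε hε => ?_
  obtain ⟨h₁, γ₁, hh₁, hγ₁, e₁⟩ := hP.exists_cost_lt ha'.le hε
  obtain ⟨h₂, γ₂, hh₂, hγ₂, e₂⟩ := hP.exists_cost_lt hb'.le hε
  have hh : P.Admissible fun t => θ * h₁ t + η * h₂ t :=
    ⟨(hh₁.1.const_mul θ).add (hh₂.1.const_mul η), fun t ht =>
      convex_Icc (0 : ℝ) P.hmax (hh₁.2 t ht) (hh₂.2 t ht) hθ hη hθη⟩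
  obtain ⟨γ, hγ⟩ := hP.exists_state hh (inv_pos.2 hm).le
  have I1 := (hP.integrableOn_running ha'.le hh₁ hγ₁).const_mul θ
  have I2 := (hP.integrableOn_running hb'.le hh₂ hγ₂).const_mul η
  have key : P.cost (fun t => θ * h₁ t + η * h₂ t) γ ≤ θ * P.cost h₁ γ₁ + η * P.cost h₂ γ₂ := by
    rw [cost, cost, cost, ← integral_const_mul, ← integral_const_mul, ← integral_add I1 I2]
    refine setIntegral_mono_on (hP.integrableOn_running (inv_pos.2 hm).le hh hγ) (I1.add I2)
      measurableSet_Ioi fun t ht => ?_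
    have ht' : 0 ≤ t := le_of_lt ht
    have h3 := hP.state_le_harmonic ha' hb' hθ hη hθη hh₁ hh₂ hh hγ₁ hγ₂ (by simpa using hγ) ht'
    have p1 := hP.state_pos ha' hh₁ hγ₁ ht'
    have p2 := hP.state_pos hb' hh₂ hγ₂ ht'
    have h4 : (θ * (γ₁ t)⁻¹ + η * (γ₂ t)⁻¹)⁻¹ ≤ θ * γ₁ t + η * γ₂ t := by
      have := (convexOn_zpow (𝕜 := ℝ) (-1)).2 (mem_Ioi.2 (inv_pos.2 p1))
        (mem_Ioi.2 (inv_pos.2 p2)) hθ hη hθη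
      simpa using this
    have h5 := hP.c_convex.convexOn.2 (mem_Ici.2 (hh₁.nonneg ht')) (mem_Ici.2 (hh₂.nonneg ht'))
      hθ hη hθη
    simp only [smul_eq_mul] at h5
    have h6 := mul_le_mul_of_nonneg_left (add_le_add
      (mul_le_mul_of_nonneg_left (h3.trans h4) hP.abar_pos.le) h5) (Real.exp_pos (-P.δ * t)).le
    linarith
  have h7 := hP.v_le (inv_pos.2 hm).le hh hγ
  have h8 := mul_le_mul_of_nonneg_left e₁.le hθ
  have h9 := mul_le_mul_of_nonneg_left e₂.le hη
  have h10 : θ * ε + η * ε = ε := by rw [← add_mul, hθη, one_mul]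
  linarith

/-- The value function is concave in the variance and convex in the precision, hence
differentiable. -/
theorem differentiableAt_v {γ : ℝ} (h0 : 0 < γ) : DifferentiableAt ℝ P.v γ := by
  obtain ⟨m, hm⟩ := hP.concaveOn_v.neg.exists_affine_support
    (show γ ∈ interior (Ici 0) by rwa [interior_Ici])
  obtain ⟨k, hk⟩ := hP.convexOn_vcheck.exists_affine_support
    (show γ⁻¹ ∈ interior (Ioi 0) by rw [interior_Ioi]; exact inv_pos.2 h0)
  have hl : HasDerivAt (fun y => P.v γ + k * (y⁻¹ - γ⁻¹)) (k * (-(γ ^ 2)⁻¹)) γ :=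
    (((hasDerivAt_inv h0.ne').sub_const _).const_mul k).const_add _
  have hu : HasDerivAt (fun y => P.v γ + -m * (y - γ)) (-m * 1) γ :=
    (((hasDerivAt_id γ).sub_const _).const_mul (-m)).const_add _
  have hs : ∀ᶠ y in nhds γ, P.v γ + k * (y⁻¹ - γ⁻¹) ≤ P.v y ∧ P.v y ≤ P.v γ + -m * (y - γ) := by
    filter_upwards [Ioi_mem_nhds h0] with y hy
    have hy' : 0 < y := hy
    constructor
    · have := hk y⁻¹ (inv_pos.2 hy')
      simpa [vcheck] using this
    · have := hm y (mem_Ici.2 hy'.le)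
      simp only [Pi.neg_apply] at this
      linarith
  -- Upper minus lower barrier has a local minimum at `γ`, so the two barriers share their slope
  -- there.
  have he : k * (-(γ ^ 2)⁻¹) = -m * 1 := by
    have hmin : IsLocalMin (fun y => (P.v γ + -m * (y - γ)) - (P.v γ + k * (y⁻¹ - γ⁻¹))) γ := by
      filter_upwards [hs] with y hy
      simp only [sub_self, mul_zero]
      linarith [hy.1, hy.2]
    have := hmin.hasDerivAt_eq_zero (hu.sub hl)
    linarith
  rw [he] at hl
  exact (hasDerivAt_of_sandwich hl hu (by simp) (by simp) hs).differentiableAt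

omit hP in
theorem γinf_nonneg : 0 ≤ P.γinf := by
  have : P.lam * P.σ₁ ^ 2 ≤ √(P.lam ^ 2 * P.σ₁ ^ 4 + P.σ₁ ^ 2 * P.σ₂ ^ 2) := by
    apply Real.le_sqrt_of_sq_le
    nlinarith [mul_nonneg (sq_nonneg P.σ₁) (sq_nonneg P.σ₂)]
  unfold γinf; linarith

theorem γmax_pos : 0 < P.γmax := γinf_nonneg.trans_lt hP.γinf_lt

omit hP in
theorem dv_eq {γ : ℝ} (h0 : 0 < γ) (h1 : γ < P.γmax) : P.dv γ = deriv P.v γ :=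
  derivWithin_of_mem_nhds (Icc_mem_nhds h0 h1)

theorem hasDerivAt_vcheck {p : ℝ} (hp : 0 < p) :
    HasDerivAt P.vcheck (-((p⁻¹) ^ 2 * deriv P.v p⁻¹)) p := by
  have h1 := (hP.differentiableAt_v (inv_pos.2 hp)).hasDerivAt.comp p (hasDerivAt_inv hp.ne')
  have e : P.vcheck = P.v ∘ fun x => x⁻¹ := by funext x; simp [vcheck]
  rw [e]
  exact h1.congr_deriv (by rw [inv_pow]; ring)

/-- The one-sided derivative at `1/γmax` is two-sided as well, because `v` is defined and
differentiable beyond `γmax`. -/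
theorem dvcheck_eq {p : ℝ} (hp : 1 / P.γmax ≤ p) :
    P.dvcheck p = -((p⁻¹) ^ 2 * deriv P.v p⁻¹) :=
  (hP.hasDerivAt_vcheck ((one_div_pos.2 hP.γmax_pos).trans_le hp)).hasDerivWithinAt.derivWithin
    (uniqueDiffOn_Ici _ p hp)

theorem sq_mul_deriv_v_mono {a b : ℝ} (ha : 0 < a) (hab : a ≤ b) :
    a ^ 2 * deriv P.v a ≤ b ^ 2 * deriv P.v b := by
  have hb := ha.trans_le hab
  have h := hP.convexOn_vcheck.monotoneOn_deriv
    (fun p hp => (hP.hasDerivAt_vcheck hp).differentiableAt) (mem_Ioi.2 (inv_pos.2 hb))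
    (mem_Ioi.2 (inv_pos.2 ha)) (inv_anti₀ ha hab)
  rw [(hP.hasDerivAt_vcheck (inv_pos.2 hb)).deriv, (hP.hasDerivAt_vcheck (inv_pos.2 ha)).deriv,
    inv_inv, inv_inv] at h
  linarith

theorem deriv_v_le {γ : ℝ} (h0 : 0 < γ) : deriv P.v γ ≤ P.abar / P.δ := by
  have h1 := hP.concaveOn_v.deriv_le_slope (mem_Ici.2 (show 0 ≤ γ / 2 by linarith))
    (mem_Ici.2 h0.le) (by linarith) (hP.differentiableAt_v h0)
  have h2 := hP.v_sub_le (show 0 ≤ γ / 2 by linarith) (show γ / 2 ≤ γ by linarith)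
  rw [slope_def_field] at h1
  refine h1.trans ?_
  rwa [div_le_iff₀ (by linarith)]

/-- This keeps the argument of `ĥ` in the range where `c'` can be inverted, so that `H*` stays below
`h_max`. -/
theorem sq_mul_deriv_v_le_M₀ {γ : ℝ} (h0 : 0 < γ) (h1 : γ ≤ P.γmax) :
    γ ^ 2 * deriv P.v γ ≤ P.M₀ := by
  have := div_pos hP.abar_pos hP.δ_pos
  unfold M₀
  calc γ ^ 2 * deriv P.v γ ≤ γ ^ 2 * (P.abar / P.δ) := by
        gcongr; exact hP.deriv_v_le h0
    _ ≤ _ := by gcongr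

/-! ### Verification at a rest point of the Pontryagin system. -/

/-- Verification: a stationary extremal yields an affine minorant, in the precision, of all costs. -/
theorem le_cost_of_stationary {γs hs m : ℝ} (hγs : 0 < γs)
    (hf : P.f γs hs = 0) (hm0 : 0 < m)
    (hm : m * (P.δ - 2 * P.lam + 2 * P.σ₂ ^ 2 * γs⁻¹) = P.abar)
    (htan : ∀ h, 0 ≤ h → P.c hs + γs ^ 2 * m * (h - hs) ≤ P.c h)
    {γ₀ : ℝ} (h0 : 0 < γ₀) {h γ : ℝ → ℝ} (hh : P.Admissible h) (hγ : P.IsState h γ₀ γ) :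
    (P.abar * γs + P.c hs) / P.δ - γs ^ 2 * m * (γ₀⁻¹ - γs⁻¹) ≤ P.cost h γ := by
  set k := P.abar * γs + P.c hs with hk
  set Q := γs ^ 2 * m with hQ
  have hQ0 : 0 < Q := by positivity
  have hδ := hP.δ_pos
  have hpos : ∀ t, 0 ≤ t → 0 < γ t := fun t => hP.state_pos h0 hh hγ
  have hstat : P.sbar ^ 2 + hs + 2 * P.lam * γs⁻¹ - P.σ₂ ^ 2 * γs⁻¹ ^ 2 = 0 := by
    have : P.sbar ^ 2 + hs + 2 * P.lam * γs⁻¹ - P.σ₂ ^ 2 * γs⁻¹ ^ 2 = -P.f γs hs / γs ^ 2 := by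
      unfold f; field_simp; ring
    rw [this, hf]; simp
  have hprim := (IsPrimitive.exp_mul (-P.δ)).mul
    ((((hγ.isPrimitive hh).inv hpos).sub (IsPrimitive.const γs⁻¹)).const_mul Q)
  have hpt : ∀ t, 0 ≤ t → k * Real.exp (-P.δ * t) + (-P.δ * Real.exp (-P.δ * t) *
      (Q * ((γ t)⁻¹ - γs⁻¹)) + Real.exp (-P.δ * t) * (Q * (-P.f (γ t) (h t) / γ t ^ 2 - 0))) ≤
      Real.exp (-P.δ * t) * (P.abar * γ t + P.c (h t)) := fun t ht => by
    have hg := hpos t ht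
    have hc := htan (h t) (hh.nonneg ht)
    have inner : -P.f (γ t) (h t) / γ t ^ 2 =
        P.sbar ^ 2 + h t + 2 * P.lam * (γ t)⁻¹ - P.σ₂ ^ 2 * (γ t)⁻¹ ^ 2 := by
      unfold f; field_simp; ring
    rw [inner]
    have hx : P.abar * γ t - P.abar * γs + P.abar * γs ^ 2 * ((γ t)⁻¹ - γs⁻¹) =
        P.abar * (γ t - γs) ^ 2 * (γ t)⁻¹ := by field_simp; ring
    have hx0 : 0 ≤ P.abar * (γ t - γs) ^ 2 * (γ t)⁻¹ := by
      have := hP.abar_pos; positivity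
    have hQD : P.abar * γs ^ 2 = Q * (P.δ - 2 * P.lam + 2 * P.σ₂ ^ 2 * γs⁻¹) := by
      rw [hQ, ← hm]; ring
    rw [hQD] at hx
    have hy0 : 0 ≤ Q * P.σ₂ ^ 2 * ((γ t)⁻¹ - γs⁻¹) ^ 2 := by positivity
    have hstat' : P.sbar ^ 2 = P.σ₂ ^ 2 * γs⁻¹ ^ 2 - hs - 2 * P.lam * γs⁻¹ := by linarith
    -- The slack is a sum of three nonnegative terms: the tangent gap of `c` at `hs`, the tangent
    -- gap `hx0` of the convex function `ā/p`, and the quadratic term `hy0` of the precision drift.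
    -- The terms linear in `1/γ - 1/γs` cancel by the equation for `m`.
    have main : k + (-P.δ * (Q * ((γ t)⁻¹ - γs⁻¹)) +
        Q * (P.sbar ^ 2 + h t + 2 * P.lam * (γ t)⁻¹ - P.σ₂ ^ 2 * (γ t)⁻¹ ^ 2 - 0)) ≤
        P.abar * γ t + P.c (h t) := by
      rw [hstat', hk]
      linarith
    have := mul_le_mul_of_nonneg_left main (Real.exp_pos (-P.δ * t)).le
    linarith
  have hI := hP.integrableOn_running h0.le hh hγ
  have hbound : ∀ T, 0 ≤ T → k * ((1 - Real.exp (-P.δ * T)) / P.δ) +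
      (Real.exp (-P.δ * T) * (Q * (0 - γs⁻¹)) - Q * (γ₀⁻¹ - γs⁻¹)) ≤ P.cost h γ := fun T hT => by
    have e1 : ∫ t in (0 : ℝ)..T, k * Real.exp (-P.δ * t) =
        k * ((1 - Real.exp (-P.δ * T)) / P.δ) := by
      rw [intervalIntegral.integral_const_mul,
        intervalIntegral.integral_comp_mul_left _ (neg_ne_zero.2 hδ.ne'), _root_.integral_exp]
      simp only [mul_zero, Real.exp_zero, smul_eq_mul]
      field_simp; ring
    have e2 := hprim.integral_eq_sub le_rfl hT
    have i1 : IntervalIntegrable (fun t => k * Real.exp (-P.δ * t)) volume 0 T :=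
      Continuous.intervalIntegrable (by fun_prop) _ _
    have i2 := hprim.intervalIntegrable le_rfl hT
    have i3 : IntervalIntegrable (fun t => Real.exp (-P.δ * t) * (P.abar * γ t + P.c (h t)))
        volume 0 T :=
      (intervalIntegrable_iff_integrableOn_Ioc_of_le hT).2 (hI.mono_set Ioc_subset_Ioi_self)
    have hle := intervalIntegral.integral_mono_on hT (i1.add i2) i3 fun t ht => hpt t ht.1
    rw [intervalIntegral.integral_add i1 i2, e1, e2] at hle
    have hle2 : ∫ t in (0 : ℝ)..T, Real.exp (-P.δ * t) * (P.abar * γ t + P.c (h t)) ≤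
        P.cost h γ := by
      rw [intervalIntegral.integral_of_le hT]
      refine setIntegral_mono_set hI ?_ Ioc_subset_Ioi_self.eventuallyLE
      filter_upwards [ae_restrict_mem measurableSet_Ioi] with t ht
        using hP.running_nonneg h0.le hh hγ (le_of_lt ht)
    refine le_trans (le_trans ?_ hle) hle2
    simp only [hγ.init, mul_zero, Real.exp_zero, one_mul]
    -- The terminal precision enters with a positive sign and is dropped, so no bound on it is
    -- needed as `T → ∞`.
    have := inv_pos.2 (hpos T hT)
    gcongr
  have hlim : Filter.Tendsto (fun T => k * ((1 - Real.exp (-P.δ * T)) / P.δ) +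
      (Real.exp (-P.δ * T) * (Q * (0 - γs⁻¹)) - Q * (γ₀⁻¹ - γs⁻¹))) Filter.atTop
      (nhds (k * ((1 - 0) / P.δ) + (0 * (Q * (0 - γs⁻¹)) - Q * (γ₀⁻¹ - γs⁻¹)))) := by
    have he : Filter.Tendsto (fun T => Real.exp (-P.δ * T)) Filter.atTop (nhds 0) :=
      Real.tendsto_exp_atBot.comp
        (Filter.tendsto_id.const_mul_atTop_of_neg (by linarith : -P.δ < 0))
    exact (((tendsto_const_nhds.sub he).div_const _).const_mul _).add
      ((he.mul_const _).sub_const _)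
  have := le_of_tendsto hlim ((Filter.eventually_ge_atTop 0).mono hbound)
  refine le_trans (le_of_eq ?_) this
  ring

theorem v_eq_of_stationary {γs hs m : ℝ} (hγs : 0 < γs) (hs0 : 0 ≤ hs) (hs1 : hs ≤ P.hmax)
    (hf : P.f γs hs = 0) (hm0 : 0 < m)
    (hm : m * (P.δ - 2 * P.lam + 2 * P.σ₂ ^ 2 * γs⁻¹) = P.abar)
    (htan : ∀ h, 0 ≤ h → P.c hs + γs ^ 2 * m * (h - hs) ≤ P.c h) :
    P.v γs = (P.abar * γs + P.c hs) / P.δ ∧ deriv P.v γs = m := by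
  have hlow : ∀ γ, 0 < γ →
      (P.abar * γs + P.c hs) / P.δ - γs ^ 2 * m * (γ⁻¹ - γs⁻¹) ≤ P.v γ := fun γ h0 =>
    hP.le_v h0.le fun h g hh hg => hP.le_cost_of_stationary hγs hf hm0 hm htan h0 hh hg
  have hv : P.v γs = (P.abar * γs + P.c hs) / P.δ := by
    refine le_antisymm ?_ (by simpa using hlow γs hγs)
    refine (hP.v_le hγs.le (admissible_const hs0 hs1) (γ := fun _ => γs)
      ⟨continuousOn_const, fun t _ => by simp [hf]⟩).trans (le_of_eq ?_)
    rw [cost, integral_mul_const, hP.integral_exp]; ring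
  refine ⟨hv, ?_⟩
  have hd : HasDerivAt (fun y => (P.abar * γs + P.c hs) / P.δ - γs ^ 2 * m * (y⁻¹ - γs⁻¹))
      (-(γs ^ 2 * m * (-(γs ^ 2)⁻¹))) γs :=
    (((hasDerivAt_inv hγs.ne').sub_const _).const_mul _).const_sub _
  have hmin : IsLocalMin (fun y => P.v y -
      ((P.abar * γs + P.c hs) / P.δ - γs ^ 2 * m * (y⁻¹ - γs⁻¹))) γs := by
    filter_upwards [Ioi_mem_nhds hγs] with y hy
    have := hlow y hy
    simp only [sub_self, mul_zero, hv]
    linarith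
  have := hmin.hasDerivAt_eq_zero ((hP.differentiableAt_v hγs).hasDerivAt.sub hd)
  have e : γs ^ 2 * m * (-(γs ^ 2)⁻¹) = -m := by field_simp
  rw [e] at this
  linarith

end Standing

end Model

end InfoAcq

/-! ### Equilibria and the threshold `γ_D`. -/

namespace InfoAcq

namespace Model

namespace Standing

variable {P : Model} (hP : P.Standing)
include hP

theorem f_γinf : P.f P.γinf 0 = 0 := by
  have hσ := hP.σ₁_pos.ne'
  have hS := Real.sq_sqrt (show 0 ≤ P.lam ^ 2 * P.σ₁ ^ 4 + P.σ₁ ^ 2 * P.σ₂ ^ 2 by positivity)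
  unfold f γinf sbar
  set S := √(P.lam ^ 2 * P.σ₁ ^ 4 + P.σ₁ ^ 2 * P.σ₂ ^ 2)
  field_simp
  linear_combination -hS

theorem f_zero_nonneg {γ : ℝ} (h0 : 0 ≤ γ) (h1 : γ ≤ P.γinf) : 0 ≤ P.f γ 0 :=
  hP.f_γinf.ge.trans (hP.f_le_f h0 h1 le_rfl)

theorem γinf_pos (hσ : 0 < P.σ₂) : 0 < P.γinf := by
  refine lt_of_le_of_ne γinf_nonneg fun h => ?_
  have := hP.f_γinf
  rw [← h] at this
  simp [f] at this
  exact hσ.ne' this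

theorem two_lam_lt {γ : ℝ} (h0 : 0 < γ) (h1 : γ ≤ P.γinf) : 2 * P.lam < P.σ₂ ^ 2 * γ⁻¹ := by
  have h := hP.f_zero_nonneg h0.le h1
  rw [← div_eq_mul_inv, lt_div_iff₀ h0]
  have : 0 < P.sbar ^ 2 * γ ^ 2 := by have := hP.sbar_pos; positivity
  unfold f at h
  linarith

omit hP in
theorem f_eq_zero_iff {γ h : ℝ} (h0 : γ ≠ 0) :
    P.f γ h = 0 ↔ h = P.σ₂ ^ 2 * γ⁻¹ ^ 2 - 2 * P.lam * γ⁻¹ - P.sbar ^ 2 := by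
  have : P.f γ h = γ ^ 2 * (P.σ₂ ^ 2 * γ⁻¹ ^ 2 - 2 * P.lam * γ⁻¹ - P.sbar ^ 2 - h) := by
    unfold f; field_simp; ring
  rw [this, mul_eq_zero, or_iff_right (pow_ne_zero 2 h0), sub_eq_zero, eq_comm]

theorem hhat_le_hmax {x : ℝ} (hx : x ≤ P.M₀) : P.hhat x ≤ P.hmax := hP.hhat_mono hx le_rfl

/-- Expresses that `ĥ(x)` minimizes `c(h) - xh` over `h ≥ 0`. For `x` below `c'(0)` the minimum sits
at the boundary point `0`. -/
theorem tangent_hhat {x : ℝ} (hx : x ≤ P.M₀) {h : ℝ} (hh : 0 ≤ h) :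
    P.c (P.hhat x) + x * (h - P.hhat x) ≤ P.c h := by
  rcases le_total x (P.dc 0) with h1 | h1
  · rw [hP.hhat_of_le h1]
    have := hP.tangent_le_c hh le_rfl
    nlinarith [mul_nonneg (sub_nonneg.2 h1) hh]
  · have h2 := hP.hhat_spec h1 hx
    have := hP.tangent_le_c hh h2.1
    rwa [h2.2] at this

/-- Existence of a stationary extremal. -/
theorem exists_stationary (hσ : 0 < P.σ₂) : ∃ γ m, 0 < γ ∧ γ ≤ P.γinf ∧ 0 < m ∧
    m * (P.δ - 2 * P.lam + 2 * P.σ₂ ^ 2 * γ⁻¹) = P.abar ∧ γ ^ 2 * m ≤ P.M₀ ∧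
    P.f γ (P.hhat (γ ^ 2 * m)) = 0 := by
  have hδ := hP.δ_pos
  have ha := hP.abar_pos
  have hg := hP.γinf_pos hσ
  have hl := hP.lam_nonneg
  -- `D` is `δ - ∂f/∂γ` with the rate eliminated by `f = 0`. By `two_lam_lt` it is at least `δ` on
  -- `(0, γ⁰_∞]`.
  set D : ℝ → ℝ := fun γ => P.δ - 2 * P.lam + 2 * P.σ₂ ^ 2 * γ⁻¹ with hD
  have hDδ : ∀ γ, 0 < γ → γ ≤ P.γinf → P.δ ≤ D γ := fun γ h0 h1 => by
    have := hP.two_lam_lt h0 h1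
    simp only [hD]; linarith
  have hX : ∀ γ, 0 < γ → γ ≤ P.γinf → γ ^ 2 * (P.abar / D γ) ≤ P.M₀ := fun γ h0 h1 => by
    have h2 := hDδ γ h0 h1
    have h3 := h1.trans hP.γinf_lt.le
    unfold M₀
    have := div_nonneg ha.le (hδ.le.trans h2)
    gcongr
  suffices ∃ γ, 0 < γ ∧ γ ≤ P.γinf ∧ P.f γ (P.hhat (γ ^ 2 * (P.abar / D γ))) = 0 by
    obtain ⟨γ, h0, h1, h2⟩ := this
    have hDp : 0 < D γ := hδ.trans_le (hDδ γ h0 h1)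
    exact ⟨γ, P.abar / D γ, h0, h1, div_pos ha hDp, div_mul_cancel₀ _ hDp.ne', hX γ h0 h1, h2⟩
  -- If the marginal value of information at `γ⁰_∞` is at most `c'(0)`, acquiring none is stationary
  -- and `γ⁰_∞` itself works.
  rcases le_or_gt (P.γinf ^ 2 * (P.abar / D P.γinf)) (P.dc 0) with hA | hB
  · exact ⟨P.γinf, hg, le_rfl, by rw [hP.hhat_of_le hA, hP.f_γinf]⟩
  obtain ⟨k, hk, hk'⟩ := hP.exists_dc
  -- `η γ` is the rate that makes `γ` a rest point.
  set η : ℝ → ℝ := fun γ => P.σ₂ ^ 2 * γ⁻¹ ^ 2 - 2 * P.lam * γ⁻¹ - P.sbar ^ 2 with hη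
  have hfη : ∀ γ h, γ ≠ 0 → P.f γ h = γ ^ 2 * (η γ - h) := fun γ h h0 => by
    simp only [hη]; unfold f; field_simp; ring
  have hη0 : ∀ γ, 0 < γ → γ ≤ P.γinf → 0 ≤ η γ := fun γ h0 h1 => by
    have := hP.f_zero_nonneg h0.le h1
    rw [hfη γ 0 h0.ne', sub_zero] at this
    exact nonneg_of_mul_nonneg_right this (by positivity)
  obtain ⟨ε, hε0, hε1, hε2⟩ : ∃ ε, 0 < ε ∧ ε ≤ P.γinf ∧ 0 < P.f ε k := by
    have hc : Continuous fun γ => P.f γ k := by unfold f; fun_prop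
    have h1 : ∀ᶠ γ in nhdsWithin 0 (Ioi 0), 0 < P.f γ k :=
      (hc.continuousAt.eventually_const_lt (by simp [f, hσ])).filter_mono nhdsWithin_le_nhds
    have h2 : ∀ᶠ γ in nhdsWithin 0 (Ioi 0), γ ∈ Ioc 0 P.γinf := Ioc_mem_nhdsGT hg
    obtain ⟨ε, h3, h4⟩ := (h1.and h2).exists
    exact ⟨ε, h4.1, h4.2, h3⟩
  have hkη : k ≤ η ε := by
    rw [hfη ε k hε0.ne'] at hε2
    linarith [pos_of_mul_pos_right hε2 (sq_nonneg ε)]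
  have hpos : ∀ γ ∈ Icc ε P.γinf, 0 < γ := fun γ h => hε0.trans_le h.1
  have hinv : ContinuousOn (fun γ : ℝ => γ⁻¹) (Icc ε P.γinf) :=
    continuousOn_inv₀.mono fun γ h => (hpos γ h).ne'
  have hηc : ContinuousOn η (Icc ε P.γinf) := by simp only [hη]; fun_prop
  have hXc : ContinuousOn (fun γ => γ ^ 2 * (P.abar / D γ)) (Icc ε P.γinf) := by
    have : ContinuousOn D (Icc ε P.γinf) := by simp only [hD]; fun_prop
    exact (continuousOn_id.pow 2).mul (continuousOn_const.div this fun γ h =>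
      (hδ.trans_le (hDδ γ (hpos γ h) h.2)).ne')
  have hψ : ContinuousOn (fun γ => P.dc (η γ) - γ ^ 2 * (P.abar / D γ)) (Icc ε P.γinf) :=
    (hP.continuousOn_dc.comp hηc fun γ h => hη0 γ (hpos γ h) h.2).sub hXc
  have hηinf : η P.γinf = 0 := by
    have := hP.f_γinf
    rw [hfη _ _ hg.ne', sub_zero, mul_eq_zero, or_iff_right (pow_ne_zero 2 hg.ne')] at this
    exact this
  -- Sign change of `c'(η γ) - γ²ā/D γ`: at `γ⁰_∞` one has `η = 0` and the case assumption; at `ε`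
  -- one has `η ≥ k`, where `c'` already reaches `M₀`.
  obtain ⟨γ, hγ, e⟩ := intermediate_value_Icc' hε1 hψ (show (0 : ℝ) ∈ Icc _ _ from
    ⟨by simp only [hηinf]; linarith, by
      have h1 := hP.strictMonoOn_dc.monotoneOn (mem_Ici.2 hk) (mem_Ici.2 (hk.trans hkη)) hkη
      have h2 := hX ε hε0 hε1
      exact sub_nonneg.2 (h2.trans (hk'.trans h1))⟩)
  refine ⟨γ, hpos γ hγ, hγ.2, ?_⟩
  have e' : γ ^ 2 * (P.abar / D γ) = P.dc (η γ) := by simp only at e; linarith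
  rw [e', hP.hhat_dc (hη0 γ (hpos γ hγ) hγ.2), hfη _ _ (hpos γ hγ).ne', sub_self, mul_zero]

theorem H_eq {γ : ℝ} (h0 : 0 < γ) (h1 : γ ≤ P.γinf) : P.H γ = P.hhat (γ ^ 2 * deriv P.v γ) := by
  rw [H, dv_eq h0 (h1.trans_lt hP.γinf_lt)]

omit hP in
theorem _root_.InfoAcq.Model.IsEquilibrium.pos (hσ : 0 < P.σ₂) {γ : ℝ} (h : P.IsEquilibrium γ) : 0 < γ := by
  refine lt_of_le_of_ne h.1.1 fun e => ?_
  have := h.2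
  rw [← e] at this
  simp [f] at this
  exact hσ.ne' this

theorem equilibrium_unique (hσ : 0 < P.σ₂) {a b : ℝ} (ha : P.IsEquilibrium a)
    (hb : P.IsEquilibrium b) : a = b := by
  wlog hab : a < b generalizing a b
  · rcases lt_trichotomy a b with h | h | h
    exacts [this ha hb h, h, (this hb ha h).symm]
  exfalso
  have ha0 := ha.pos hσ
  have hb0 := ha0.trans hab
  have hH : P.H a ≤ P.H b := by
    rw [hP.H_eq ha0 ha.1.2, hP.H_eq hb0 hb.1.2]
    exact hP.hhat_mono (hP.sq_mul_deriv_v_mono ha0 hab.le)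
      (hP.sq_mul_deriv_v_le_M₀ hb0 (hb.1.2.trans hP.γinf_lt.le))
  rw [(f_eq_zero_iff ha0.ne').1 ha.2, (f_eq_zero_iff hb0.ne').1 hb.2] at hH
  have h1 := hP.two_lam_lt ha0 ha.1.2
  have h2 := hP.two_lam_lt hb0 hb.1.2
  have h3 : b⁻¹ < a⁻¹ := inv_strictAnti₀ ha0 hab
  have h4 : 0 < (a⁻¹ - b⁻¹) * (P.σ₂ ^ 2 * a⁻¹ + P.σ₂ ^ 2 * b⁻¹ - 2 * P.lam) :=
    mul_pos (by linarith) (by linarith [hP.lam_nonneg])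
  nlinarith

/-- With positive exogenous volatility the equilibrium is the stationary extremal. -/
theorem exists_equilibrium (hσ : 0 < P.σ₂) : ∃ γ, P.IsEquilibrium γ ∧ 0 < deriv P.v γ ∧
    deriv P.v γ * (P.δ - 2 * P.lam + 2 * P.σ₂ ^ 2 * γ⁻¹) = P.abar ∧
    P.v γ = (P.abar * γ + P.c (P.H γ)) / P.δ := by
  obtain ⟨γ, m, h0, h1, hm0, hm, hM, hf⟩ := hP.exists_stationary hσ
  obtain ⟨hv, hd⟩ := hP.v_eq_of_stationary h0 (hP.hhat_nonneg hM) (hP.hhat_le_hmax hM) hf hm0 hm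
    fun h hh => hP.tangent_hhat hM hh
  have hH : P.H γ = P.hhat (γ ^ 2 * m) := by rw [hP.H_eq h0 h1, hd]
  refine ⟨γ, ⟨⟨h0.le, h1⟩, by rwa [hH]⟩, by rwa [hd], by rwa [hd], by rwa [hH]⟩

/-- `v̌'` is not shown to be injective. Every preimage of `-c'(0)` satisfies this equation, and
together with monotonicity it suffices, so the choice of preimage is immaterial. -/
theorem γD_of_mem (h0 : P.dc 0 ≠ 0) (h : -P.dc 0 ∈ P.dvcheck '' Ici (1 / P.γmax)) :
    0 < P.γD ∧ P.γD ^ 2 * deriv P.v P.γD = P.dc 0 := by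
  have e : P.γD = (Function.invFunOn P.dvcheck (Ici (1 / P.γmax)) (-P.dc 0))⁻¹ := by
    rw [γD, if_neg h0, if_pos h, one_div]
  have hp := Function.invFunOn_mem h
  have hq := Function.invFunOn_eq h
  rw [hP.dvcheck_eq hp] at hq
  rw [e]
  exact ⟨inv_pos.2 ((one_div_pos.2 hP.γmax_pos).trans_le hp), neg_injective hq⟩

theorem sq_mul_deriv_v_le_of_le_γD {γ : ℝ} (h0 : 0 < γ) (h1 : γ ≤ P.γmax) (hD : γ ≤ P.γD) :
    γ ^ 2 * deriv P.v γ ≤ P.dc 0 := by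
  by_cases hc : P.dc 0 = 0
  · rw [γD, if_pos hc] at hD
    exact absurd h0 (not_lt.2 hD)
  by_cases hm : -P.dc 0 ∈ P.dvcheck '' Ici (1 / P.γmax)
  · rw [← (hP.γD_of_mem hc hm).2]
    exact hP.sq_mul_deriv_v_mono h0 hD
  by_contra! hlt
  apply hm
  have hc0 : 0 < P.dc 0 := lt_of_le_of_ne hP.dc_zero_nonneg (Ne.symm hc)
  have hdiff : DifferentiableOn ℝ P.vcheck (Ici (1 / P.γmax)) := fun p hp =>
    (hP.hasDerivAt_vcheck ((one_div_pos.2 hP.γmax_pos).trans_le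
      hp)).differentiableAt.differentiableWithinAt
  obtain ⟨ε, hε0, hε1, hε2⟩ : ∃ ε, 0 < ε ∧ ε ≤ P.γmax ∧ ε ^ 2 * (P.abar / P.δ) < P.dc 0 := by
    have hcont : Continuous fun γ : ℝ => γ ^ 2 * (P.abar / P.δ) := by fun_prop
    have h1 : ∀ᶠ γ in nhdsWithin 0 (Ioi 0), γ ^ 2 * (P.abar / P.δ) < P.dc 0 :=
      (hcont.continuousAt.eventually_lt_const (by simpa using hc0)).filter_mono
        nhdsWithin_le_nhds
    have h2 : ∀ᶠ γ in nhdsWithin 0 (Ioi 0), γ ∈ Ioc 0 P.γmax := Ioc_mem_nhdsGT hP.γmax_pos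
    obtain ⟨ε, h3, h4⟩ := (h1.and h2).exists
    exact ⟨ε, h4.1, h4.2, h3⟩
  have key : ∀ x, 0 < x → x ≤ P.γmax → -(x ^ 2 * deriv P.v x) ∈ P.dvcheck '' Ici (1 / P.γmax) :=
    fun x hx hxm => by
      have hp : 1 / P.γmax ≤ x⁻¹ := by rw [one_div]; exact inv_anti₀ hx hxm
      exact ⟨x⁻¹, hp, by rw [hP.dvcheck_eq hp, inv_inv]⟩
  -- Darboux's property of derivatives: `γ²v'(γ)` exceeds `c'(0)` at the given point and falls below
  -- it at `ε`, so `-c'(0)` would be a value of `v̌'`. Continuity of `v'` is not needed.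
  refine (ordConnected_Ici.image_derivWithin hdiff).out (key γ h0 h1) (key ε hε0 hε1)
    ⟨by linarith, ?_⟩
  have := mul_le_mul_of_nonneg_left (hP.deriv_v_le hε0) (sq_nonneg ε)
  linarith

theorem le_sq_mul_deriv_v_of_γD_lt {γ : ℝ} (h0 : 0 < γ) (h1 : γ ≤ P.γmax) (hD : P.γD < γ)
    (hd : 0 ≤ deriv P.v γ) : P.dc 0 ≤ γ ^ 2 * deriv P.v γ := by
  by_cases hc : P.dc 0 = 0
  · rw [hc]; positivity
  by_cases hm : -P.dc 0 ∈ P.dvcheck '' Ici (1 / P.γmax)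
  · obtain ⟨hp, he⟩ := hP.γD_of_mem hc hm
    rw [← he]
    exact hP.sq_mul_deriv_v_mono hp hD.le
  · rw [γD, if_neg hc, if_neg hm] at hD
    linarith

theorem γinf_eq_zero (hσ : P.σ₂ = 0) : P.γinf = 0 := by
  have h : P.lam ^ 2 * P.σ₁ ^ 4 + P.σ₁ ^ 2 * P.σ₂ ^ 2 = (P.lam * P.σ₁ ^ 2) ^ 2 := by
    rw [hσ]; ring
  rw [γinf, h, Real.sqrt_sq (mul_nonneg hP.lam_nonneg (sq_nonneg _))]
  ring

theorem H_zero : P.H 0 = 0 :=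
  hP.hhat_of_le (by simpa using hP.dc_zero_nonneg)

theorem v_zero (hσ : P.σ₂ = 0) : P.v 0 = P.c 0 / P.δ := by
  have e : P.c 0 / P.δ = ∫ t in Ioi (0 : ℝ), Real.exp (-P.δ * t) * P.c 0 := by
    rw [integral_mul_const, hP.integral_exp]; ring
  apply le_antisymm
  · refine (hP.v_le le_rfl (admissible_const le_rfl hP.hmax_nonneg) (γ := fun _ => 0)
      ⟨continuousOn_const, fun t _ => by simp [f, hσ]⟩).trans (le_of_eq ?_)
    rw [e, cost]; simp
  · refine hP.le_v le_rfl fun h γ hh hγ => ?_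
    rw [e, cost]
    refine setIntegral_mono_on (hP.integrableOn_exp.mul_const _)
      (hP.integrableOn_running le_rfl hh hγ) measurableSet_Ioi fun t ht => ?_
    have ht' : 0 ≤ t := le_of_lt ht
    have h1 := hP.state_nonneg le_rfl hh hγ ht'
    have h2 := hP.c_mono.monotoneOn (mem_Ici.2 le_rfl) (mem_Ici.2 (hh.nonneg ht')) (hh.nonneg ht')
    have := mul_nonneg hP.abar_pos.le h1
    gcongr
    linarith

end Standing

end Model

end InfoAcq

/-! ### The cases `σ₂ = 0` and `σ₂ > 0` combined. -/

theorem mainTheorem8 (P : InfoAcq.Model)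
    (hlam : 0 ≤ P.lam) (hσ₁ : 0 < P.σ₁) (hσ₂ : 0 ≤ P.σ₂)
    (hκ : 0 < P.κ) (hρ : 0 < P.ρ) (hδ : 0 < P.δ) (hγmax : P.γinf < P.γmax)
    (hc_nonneg : ∀ x, 0 ≤ x → 0 ≤ P.c x)
    (hc_convex : StrictConvexOn ℝ (Set.Ici 0) P.c)
    (hc_smooth : ContDiffOn ℝ 2 P.c (Set.Ici 0))
    (hc_mono : StrictMonoOn P.c (Set.Ici 0))
    (hM₀ : ∃ h, 0 ≤ h ∧ P.M₀ ≤ P.dc h) :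
    (∃! γ, P.IsEquilibrium γ) ∧
    ∀ γeq heq : ℝ, P.IsEquilibrium γeq → heq = P.H γeq →
      P.v γeq = 1 / P.δ * (P.abar * γeq + P.c heq) ∧
      (γeq ∈ Set.Icc 0 P.γD → heq = 0) ∧
      (γeq ∈ Set.Ioo 0 P.γD →
        HasDerivAt P.v (P.abar / (2 * P.sbar ^ 2 * γeq + 2 * P.lam + P.δ)) γeq) ∧
      (γeq ∈ Set.Ioc P.γD P.γmax →
        HasDerivAt P.v
          (1 / γeq ^ 2 *
            P.dc (-(1 / γeq ^ 2) * (2 * P.lam * γeq - P.σ₂ ^ 2) - P.sbar ^ 2)) γeq ∧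
        heq = -(1 / γeq ^ 2) * (2 * P.lam * γeq - P.σ₂ ^ 2) - P.sbar ^ 2) := by
  have hP : P.Standing := ⟨hlam, hσ₁, hσ₂, hκ, hρ, hδ, hγmax, hc_nonneg, hc_convex, hc_smooth,
    hc_mono, hM₀⟩
  rcases hσ₂.eq_or_lt with hσ | hσ
  · have hinf := hP.γinf_eq_zero hσ.symm
    have hzero : ∀ γ, P.IsEquilibrium γ → γ = 0 := fun γ h =>
      le_antisymm (h.1.2.trans hinf.le) h.1.1
    refine ⟨⟨0, ⟨⟨le_rfl, hinf.ge⟩, by simp [InfoAcq.Model.f, ← hσ]⟩, hzero⟩, ?_⟩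
    rintro γeq heq hE rfl
    obtain rfl := hzero γeq hE
    rw [hP.H_zero]
    refine ⟨by rw [hP.v_zero hσ.symm]; ring, fun _ => rfl, fun h => absurd h.1 (lt_irrefl _),
      fun h => absurd h.1 (not_lt.2 ?_)⟩
    unfold InfoAcq.Model.γD
    split_ifs with h1 h2
    · exact le_rfl
    · exact one_div_nonneg.2 ((one_div_pos.2 hP.γmax_pos).le.trans (Function.invFunOn_mem h2))
    · exact hP.γmax_pos.le
  · obtain ⟨γ, hE, hd0, hd, hv⟩ := hP.exists_equilibrium hσ
    refine ⟨⟨γ, hE, fun b hb => hP.equilibrium_unique hσ hb hE⟩, ?_⟩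
    rintro γeq heq hE' rfl
    obtain rfl := hP.equilibrium_unique hσ hE hE'
    have h0 := hE.pos hσ
    have h1 := hE.1.2
    have hmax := h1.trans hγmax.le
    have hderiv := (hP.differentiableAt_v h0).hasDerivAt
    have hheq := (InfoAcq.Model.Standing.f_eq_zero_iff h0.ne').1 hE.2
    have hle : γ ≤ P.γD → P.H γ = 0 := fun h => by
      rw [hP.H_eq h0 h1]
      exact hP.hhat_of_le (hP.sq_mul_deriv_v_le_of_le_γD h0 hmax h)
    have hform : P.H γ = -(1 / γ ^ 2) * (2 * P.lam * γ - P.σ₂ ^ 2) - P.sbar ^ 2 := by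
      rw [hheq]; field_simp; ring
    refine ⟨by rw [hv]; ring, fun h => hle h.2, fun h => hderiv.congr_deriv ?_,
      fun h => ⟨hderiv.congr_deriv ?_, hform⟩⟩
    · have hs := hP.sbar_pos
      rw [eq_div_iff (by positivity), ← hd]
      rw [hle h.2.le] at hheq
      -- With zero rate the rest-point equation turns the denominator `δ - 2λ + 2σ₂²/γ` into `2σ̄₁²γ
      -- + 2λ + δ`.
      have : P.sbar ^ 2 * γ = P.σ₂ ^ 2 * γ⁻¹ - 2 * P.lam := by
        have h2 : P.sbar ^ 2 = P.σ₂ ^ 2 * γ⁻¹ ^ 2 - 2 * P.lam * γ⁻¹ := by linarith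
        rw [h2]; field_simp
      congr 1
      linarith
    · have h2 := (hP.hhat_spec (hP.le_sq_mul_deriv_v_of_γD_lt h0 hmax h.1 hd0.le)
        (hP.sq_mul_deriv_v_le_M₀ h0 hmax)).2
      rw [← hform, hP.H_eq h0 h1, h2]
      field_simp
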